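/- Let $G$ be a finite cyclic group. For a subgroup $H\le G$ let $A(H)$ be the Burnside ring of $H$ (the Grothendieck ring of the semiring of isomorphism classes of finite $H$-sets under disjoint union and Cartesian product), and for $I\le H$ let $\varphi_H^I\colon A(H)\to\mathbb Z$ be the ring homomorphism with $[X]\mapsto |X^I|$. The Burnside Tambara functor $\underline A_G$ has values $\underline A_G(G/H)=A(H)$; for $K\le H\le G$ its restriction $A(H)\to A(K)$ restricts the action, its transfer $\mathrm{tr}_K^H\colon A(K)\to A(H)$ is additive with $[X]\mapsto[H\times_K X]$, its norm $N_K^H\colon A(K)\to A(H)$ is the polynomial extension of $[X]\mapsto[\mathrm{Map}_K(H,X)]$ to virtual sets, and its conjugations are $A(H)\to A(H^g)$, where $H^g=g^{-1}Hg$. An ideal $\mathcal I$ of $\underline A_G$ is a family of ring ideals $\mathcal I(G/H)\subseteq A(H)$, $H\le G$, that is closed under restrictions, transfers and conjugations and satisfies $N_K^H(\mathcal I(G/K))\subseteq \mathcal I(G/H)+N_K^H(0)$ for all $K\le H\le G$. Inclusions of such families are taken levelwise. The product $\mathcal I\mathcal J$ has as its value at $G/H$ the set of all finite sums $\sum_i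 \mathrm{tr}_{K_i}^H(a_ib_i)$ with $K_i\le H$, $a_i\in\mathcal I(G/K_i)$, $b_i\in\mathcal J(G/K_i)$. A proper ideal $\mathcal P$ is prime if, for all ideals $\mathcal I,\mathcal J$, $\mathcal I\mathcal J\subseteq\mathcal P$ implies $\mathcal I\subseteq\mathcal P$ or $\mathcal J\subseteq\mathcal P$. For $q$ a prime number or $0$, it is said to be over $q$ if $\mathcal P(G/e)=(q)\subseteq A(e)=\mathbb Z$. For a finite group $\Gamma$, a subgroup $C\le \Gamma$ and $q$ prime or zero, put $$\mathfrak p_{C,q}(\Gamma/H)=\{x\in A(H) : \varphi_H^I(x)\in q\mathbb Z\text{ for all } I\le H\text{ such that } I^g\le C\text{ for some } g\in\Gamma\}\qquad(H\le \Gamma).$$ **Theorem.** Let $G$ be a finite cyclic group, $C\le G$, let $q$ be a prime number or $0$, and let $\mathcal P$ be a prime ideal of $\underline A_G$ over $q$. 1. For a prime $p$ dividing $|G|$ with $\mathrm{Syl}_p(C)\ne\mathrm{Syl}_p(G)$, let $\mathrm{Syl}_p(C)^+$ be the subgroup of $G$ of order $p\,|\mathrm{Syl}_p(C)|$, and let $t_p\in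 A(\mathrm{Syl}_p(C)^+)$ be the class of its transitive set of order $p$, i.e. the class $[\mathrm{Syl}_p(C)^+/K]$ with $K$ its unique subgroup of index $p$. If, for every such prime $p$, one has $t_p-p\in\mathcal P(G/\mathrm{Syl}_p(C)^+)$, then $\mathfrak p_{C,q}\subseteq\mathcal P$. 2. In particular, if for every prime $p$ dividing $|G|$ the restriction of $\mathcal P$ to $S=\mathrm{Syl}_p(G)$, i.e. the family $S/K\mapsto\mathcal P(G/K)\subseteq A(K)$ for $K\le S$, equals the family $\mathfrak p_{\mathrm{Syl}_p(C),q}$ of $\underline A_S$, then $\mathfrak p_{C,q}\subseteq\mathcal P$. -/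

import Mathlib

universe u

/-! ### The Grothendieck ring of a commutative semiring -/

/-- The Grothendieck ring of a commutative semiring: the Grothendieck group of its additive monoid,
with the multiplication extended biadditively. -/
def GrothendieckRing (R : Type*) [CommSemiring R] : Type _ := Algebra.GrothendieckAddGroup R

namespace GrothendieckRing

noncomputable instance (R : Type*) [CommSemiring R] : AddCommGroup (GrothendieckRing R) :=
  inferInstanceAs (AddCommGroup (Algebra.GrothendieckAddGroup R))

/-- The class of an element of the semiring, as an additive map. -/
noncomputable def ofAdd (R : Type*) [CommSemiring R] : R →+ GrothendieckRing R :=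
  Algebra.GrothendieckAddGroup.of (M := R)

/-- The universal property of the Grothendieck group. -/
noncomputable def liftAdd {R A : Type*} [CommSemiring R] [AddCommGroup A] (f : R →+ A) :
    GrothendieckRing R →+ A :=
  Algebra.GrothendieckAddGroup.lift f

theorem liftAdd_ofAdd {R A : Type*} [CommSemiring R] [AddCommGroup A] (f : R →+ A) (a : R) :
    liftAdd f (ofAdd R a) = f a :=
  DFunLike.congr_fun (Algebra.GrothendieckAddGroup.lift.symm_apply_apply f) a

theorem mk_eq {R : Type*} [CommSemiring R] (a b : R) :
    (AddLocalization.mk a ⟨b, trivial⟩ : Algebra.GrothendieckAddGroup R) =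
      (ofAdd R a - ofAdd R b : GrothendieckRing R) := by
  change _ = (Algebra.GrothendieckAddGroup.of a - Algebra.GrothendieckAddGroup.of b :
    Algebra.GrothendieckAddGroup R)
  simp only [Algebra.GrothendieckAddGroup.of, AddSubmonoid.LocalizationMap.toAddMonoidHom_apply,
    ← AddLocalization.mk_zero_eq_addMonoidOf_mk, Algebra.GrothendieckAddGroup.mk_sub_mk]
  congr 1
  · simp
  · ext; simp

/-- Every element is a formal difference. -/
theorem exists_eq_sub {R : Type*} [CommSemiring R] (x : GrothendieckRing R) :
    ∃ a b : R, x = ofAdd R a - ofAdd R b := by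
  obtain ⟨⟨a, b⟩, rfl⟩ : ∃ y : R × (⊤ : AddSubmonoid R), AddLocalization.mk y.1 y.2 = x :=
    AddLocalization.ind (p := fun x => ∃ y : R × (⊤ : AddSubmonoid R),
      AddLocalization.mk y.1 y.2 = x) (fun y => ⟨y, rfl⟩) x
  exact ⟨a, b, mk_eq a b⟩

/-- The biadditive extension of the multiplication. -/
noncomputable def mulHom (R : Type*) [CommSemiring R] :
    GrothendieckRing R →+ GrothendieckRing R →+ GrothendieckRing R :=
  liftAdd
    { toFun := fun a => liftAdd ((ofAdd R).comp (AddMonoidHom.mulLeft a))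
      map_zero' := by
        ext x; obtain ⟨a, b, rfl⟩ := exists_eq_sub x; simp [liftAdd_ofAdd]
      map_add' := fun c d => by
        ext x; obtain ⟨a, b, rfl⟩ := exists_eq_sub x; simp [liftAdd_ofAdd, add_mul]; abel }

theorem mulHom_ofAdd {R : Type*} [CommSemiring R] (a b : R) :
    mulHom R (ofAdd R a) (ofAdd R b) = ofAdd R (a * b) := by
  simp [mulHom, liftAdd_ofAdd]

noncomputable instance (R : Type*) [CommSemiring R] : CommRing (GrothendieckRing R) where
  __ := (inferInstance : AddCommGroup (GrothendieckRing R))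
  mul x y := mulHom R x y
  one := ofAdd R 1
  left_distrib x y z := map_add (mulHom R x) y z
  right_distrib x y z := by
    change mulHom R (x + y) z = mulHom R x z + mulHom R y z
    simp
  zero_mul x := by
    change mulHom R 0 x = 0
    simp
  mul_zero x := map_zero (mulHom R x)
  mul_assoc x y z := by
    change mulHom R (mulHom R x y) z = mulHom R x (mulHom R y z)
    obtain ⟨a, b, rfl⟩ := exists_eq_sub x
    obtain ⟨c, d, rfl⟩ := exists_eq_sub y
    obtain ⟨e, f, rfl⟩ := exists_eq_sub z
    simp only [map_sub, AddMonoidHom.sub_apply, mulHom_ofAdd, mul_assoc]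
  one_mul x := by
    change mulHom R (ofAdd R 1) x = x
    obtain ⟨a, b, rfl⟩ := exists_eq_sub x
    simp only [map_sub, mulHom_ofAdd, one_mul]
  mul_one x := by
    change mulHom R x (ofAdd R 1) = x
    obtain ⟨a, b, rfl⟩ := exists_eq_sub x
    simp only [map_sub, AddMonoidHom.sub_apply, mulHom_ofAdd, mul_one]
  mul_comm x y := by
    change mulHom R x y = mulHom R y x
    obtain ⟨a, b, rfl⟩ := exists_eq_sub x
    obtain ⟨c, d, rfl⟩ := exists_eq_sub y
    simp only [map_sub, AddMonoidHom.sub_apply, mulHom_ofAdd, mul_comm]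
    abel

/-- The canonical semiring homomorphism into the Grothendieck ring. -/
noncomputable def of (R : Type*) [CommSemiring R] : R →+* GrothendieckRing R where
  __ := ofAdd R
  map_one' := rfl
  map_mul' a b := (mulHom_ofAdd a b).symm

/-- The universal property of the Grothendieck ring. -/
noncomputable def lift {R S : Type*} [CommSemiring R] [CommRing S] (f : R →+* S) :
    GrothendieckRing R →+* S where
  __ := liftAdd f.toAddMonoidHom
  map_one' := (liftAdd_ofAdd f.toAddMonoidHom 1).trans f.map_one
  map_mul' x y := by
    change liftAdd f.toAddMonoidHom (mulHom R x y) =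
      liftAdd f.toAddMonoidHom x * liftAdd f.toAddMonoidHom y
    obtain ⟨a, b, rfl⟩ := exists_eq_sub x
    obtain ⟨c, d, rfl⟩ := exists_eq_sub y
    simp only [map_sub, AddMonoidHom.sub_apply, mulHom_ofAdd, liftAdd_ofAdd]
    simp
    ring

theorem lift_of {R S : Type*} [CommSemiring R] [CommRing S] (f : R →+* S) (a : R) :
    lift f (of R a) = f a :=
  liftAdd_ofAdd f.toAddMonoidHom a

theorem exists_eq_of_sub_of {R : Type*} [CommSemiring R] (x : GrothendieckRing R) :
    ∃ a b : R, x = of R a - of R b :=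
  exists_eq_sub x

end GrothendieckRing

/-! ### Finite sets with a group action and the Burnside ring -/

/-- A finite set with a left action of the group `Γ`. -/
structure FinGSet (Γ : Type u) [Group Γ] : Type (u + 1) where
  carrier : Type u
  [action : MulAction Γ carrier]
  [finite : Finite carrier]

attribute [instance] FinGSet.action FinGSet.finite

namespace FinGSet

variable {Γ Δ : Type u} [Group Γ] [Group Δ]

/-- Isomorphism of `Γ`-sets: an equivariant bijection. -/
def Iso (X Y : FinGSet Γ) : Prop :=
  ∃ e : X.carrier ≃ Y.carrier, ∀ (g : Γ) (x : X.carrier), e (g • x) = g • e x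

theorem Iso.refl (X : FinGSet Γ) : Iso X X := ⟨Equiv.refl _, fun _ _ => rfl⟩

theorem Iso.symm {X Y : FinGSet Γ} : Iso X Y → Iso Y X := fun ⟨e, he⟩ =>
  ⟨e.symm, fun g y => by rw [Equiv.symm_apply_eq, he, Equiv.apply_symm_apply]⟩

theorem Iso.trans {X Y Z : FinGSet Γ} : Iso X Y → Iso Y Z → Iso X Z := fun ⟨e, he⟩ ⟨f, hf⟩ =>
  ⟨e.trans f, fun g x => by simp [he, hf]⟩

instance setoid (Γ : Type u) [Group Γ] : Setoid (FinGSet Γ) :=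
  ⟨Iso, ⟨Iso.refl, Iso.symm, Iso.trans⟩⟩

/-- The empty `Γ`-set. -/
def empty (Γ : Type u) [Group Γ] : FinGSet Γ where
  carrier := PEmpty
  action := { smul := fun _ x => x, one_smul := fun _ => rfl, mul_smul := fun _ _ _ => rfl }

/-- The one-point `Γ`-set. -/
def point (Γ : Type u) [Group Γ] : FinGSet Γ where
  carrier := PUnit

/-- Disjoint union. -/
def sum (X Y : FinGSet Γ) : FinGSet Γ where
  carrier := X.carrier ⊕ Y.carrier

/-- Cartesian product with the diagonal action. -/
def prod (X Y : FinGSet Γ) : FinGSet Γ where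
  carrier := X.carrier × Y.carrier

/-- The transitive `Γ`-set `Γ/K` of left cosets. -/
def coset [Finite Γ] (K : Subgroup Γ) : FinGSet Γ where
  carrier := Γ ⧸ K

/-- The `Γ`-set obtained from a `Δ`-set by letting `Γ` act through `f : Γ → Δ`. -/
def pullback (f : Γ →* Δ) (X : FinGSet Δ) : FinGSet Γ where
  carrier := X.carrier
  action := MulAction.compHom X.carrier f

/-- The relation `(d f(γ), x) ∼ (d, γ x)` on `Δ × X`. -/
def indSetoid (f : Γ →* Δ) (X : FinGSet Γ) : Setoid (Δ × X.carrier) where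
  r a b := ∃ γ : Γ, a.1 = b.1 * f γ ∧ b.2 = γ • a.2
  iseqv :=
    { refl := fun a => ⟨1, by simp⟩
      symm := fun {a b} ⟨γ, h₁, h₂⟩ => ⟨γ⁻¹, by simp [h₁], by simp [h₂]⟩
      trans := fun {a b c} ⟨γ, h₁, h₂⟩ ⟨δ, h₃, h₄⟩ =>
        ⟨δ * γ, by simp [h₁, h₃, mul_assoc], by simp [h₂, h₄, mul_smul]⟩ }

/-- The induced `Δ`-set `Δ ×_Γ X`, the quotient of `Δ × X` by `(d f(γ), x) ∼ (d, γ x)`,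
with `Δ` acting by left translation on the first factor. -/
def induce [Finite Δ] (f : Γ →* Δ) (X : FinGSet Γ) : FinGSet Δ where
  carrier := Quotient (indSetoid f X)
  action :=
    { smul := fun δ => Quotient.map (fun a => (δ * a.1, a.2))
        fun a b ⟨γ, h₁, h₂⟩ => ⟨γ, by simp [h₁, mul_assoc], h₂⟩
      one_smul := by
        rintro ⟨a⟩
        exact congrArg (Quotient.mk (indSetoid f X)) (Prod.ext (one_mul _) rfl)
      mul_smul := by
        rintro δ ε ⟨a⟩
        exact congrArg (Quotient.mk (indSetoid f X)) (Prod.ext (mul_assoc _ _ _) rfl) }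
  finite := Quotient.finite _

/-- The coinduced `Δ`-set `Map_Γ(Δ, X)` of functions `φ : Δ → X` with `φ (f(γ) d) = γ φ(d)`,
with `Δ` acting by `(δ φ)(d) = φ(d δ)`. -/
def coinduce [Finite Δ] (f : Γ →* Δ) (X : FinGSet Γ) : FinGSet Δ where
  carrier := {φ : Δ → X.carrier // ∀ (γ : Γ) (d : Δ), φ (f γ * d) = γ • φ d}
  action :=
    { smul := fun δ φ => ⟨fun d => φ.1 (d * δ), fun γ d =>
        (congrArg φ.1 (mul_assoc (f γ) d δ)).trans (φ.2 γ (d * δ))⟩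
      one_smul := fun φ => Subtype.ext (funext fun d => congrArg φ.1 (mul_one d))
      mul_smul := fun δ ε φ => Subtype.ext (funext fun d => congrArg φ.1 (mul_assoc d δ ε).symm) }
  finite := inferInstance

theorem sum_congr {X X' Y Y' : FinGSet Γ} : Iso X X' → Iso Y Y' → Iso (sum X Y) (sum X' Y') :=
  fun ⟨e, he⟩ ⟨f, hf⟩ => ⟨Equiv.sumCongr e f, by
    rintro g (x | y)
    · exact congrArg Sum.inl (he g x)
    · exact congrArg Sum.inr (hf g y)⟩

theorem prod_congr {X X' Y Y' : FinGSet Γ} : Iso X X' → Iso Y Y' → Iso (prod X Y) (prod X' Y') :=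
  fun ⟨e, he⟩ ⟨f, hf⟩ => ⟨Equiv.prodCongr e f, fun g x => Prod.ext (he g x.1) (hf g x.2)⟩

theorem pullback_congr (f : Γ →* Δ) {X Y : FinGSet Δ} :
    Iso X Y → Iso (pullback f X) (pullback f Y) :=
  fun ⟨e, he⟩ => ⟨e, fun g x => he (f g) x⟩

theorem induce_congr [Finite Δ] (f : Γ →* Δ) {X Y : FinGSet Γ} :
    Iso X Y → Iso (induce f X) (induce f Y) :=
  fun ⟨e, he⟩ => ⟨Quotient.congr (Equiv.prodCongr (Equiv.refl Δ) e) (fun a b => by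
    constructor
    · rintro ⟨γ, h₁, h₂⟩
      exact ⟨γ, h₁, by simp [h₂, he]⟩
    · rintro ⟨γ, h₁, h₂⟩
      exact ⟨γ, h₁, e.injective (by simpa [he] using h₂)⟩), by
    rintro δ ⟨a⟩
    rfl⟩

theorem coinduce_congr [Finite Δ] (f : Γ →* Δ) {X Y : FinGSet Γ} :
    Iso X Y → Iso (coinduce f X) (coinduce f Y) :=
  fun ⟨e, he⟩ => ⟨
    { toFun := fun φ => ⟨fun d => e (φ.1 d), fun γ d =>
        (congrArg e (φ.2 γ d)).trans (he γ (φ.1 d))⟩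
      invFun := fun φ => ⟨fun d => e.symm (φ.1 d), fun γ d =>
        (congrArg e.symm (φ.2 γ d)).trans (by
          rw [Equiv.symm_apply_eq, he, Equiv.apply_symm_apply])⟩
      left_inv := fun φ => Subtype.ext (funext fun d => e.symm_apply_apply _)
      right_inv := fun φ => Subtype.ext (funext fun d => e.apply_symm_apply _) },
    fun _ _ => rfl⟩

theorem induce_sum [Finite Δ] (f : Γ →* Δ) (X Y : FinGSet Γ) :
    Iso (induce f (sum X Y)) (sum (induce f X) (induce f Y)) := by
  refine ⟨
    { toFun := Quotient.lift (fun a : Δ × (X.carrier ⊕ Y.carrier) =>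
        (Sum.map (fun x => Quotient.mk (indSetoid f X) (a.1, x))
          (fun y => Quotient.mk (indSetoid f Y) (a.1, y)) a.2 :
            Quotient (indSetoid f X) ⊕ Quotient (indSetoid f Y))) ?_
      invFun := Sum.elim
        (Quotient.map (sa := indSetoid f X) (sb := indSetoid f (sum X Y))
          (fun a => (a.1, Sum.inl a.2)) ?_)
        (Quotient.map (sa := indSetoid f Y) (sb := indSetoid f (sum X Y))
          (fun a => (a.1, Sum.inr a.2)) ?_)
      left_inv := ?_
      right_inv := ?_ }, ?_⟩
  · rintro ⟨d, x | y⟩ ⟨d', x' | y'⟩ ⟨γ, h₁, h₂⟩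
    · exact congrArg Sum.inl (Quotient.sound ⟨γ, h₁, Sum.inl_injective h₂⟩)
    · cases h₂
    · cases h₂
    · exact congrArg Sum.inr (Quotient.sound ⟨γ, h₁, Sum.inr_injective h₂⟩)
  · rintro a b ⟨γ, h₁, h₂⟩
    exact ⟨γ, h₁, congrArg Sum.inl h₂⟩
  · rintro a b ⟨γ, h₁, h₂⟩
    exact ⟨γ, h₁, congrArg Sum.inr h₂⟩
  · rintro ⟨d, x | y⟩ <;> rfl
  · rintro (⟨d, x⟩ | ⟨d, y⟩) <;> rfl
  · rintro δ ⟨d, x | y⟩ <;> rfl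

/-- The number of points of `X` fixed by the subgroup `I`. -/
noncomputable def fixedCard (I : Subgroup Γ) (X : FinGSet Γ) : ℕ :=
  Nat.card {x : X.carrier // ∀ i ∈ I, i • x = x}

theorem fixedCard_congr (I : Subgroup Γ) {X Y : FinGSet Γ} :
    Iso X Y → fixedCard I X = fixedCard I Y :=
  fun ⟨e, he⟩ => Nat.card_congr (e.subtypeEquiv fun x => by simp [← he])

end FinGSet

/-- The semiring of isomorphism classes of finite `Γ`-sets under disjoint union and product. -/
def BurnsideSemiring (Γ : Type u) [Group Γ] : Type (u + 1) := Quotient (FinGSet.setoid Γ)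

namespace BurnsideSemiring

variable {Γ Δ : Type u} [Group Γ] [Group Δ]

/-- The isomorphism class of a finite `Γ`-set. -/
def mk (X : FinGSet Γ) : BurnsideSemiring Γ := Quotient.mk _ X

theorem sound {X Y : FinGSet Γ} (h : FinGSet.Iso X Y) : mk X = mk Y := Quotient.sound h

instance : Zero (BurnsideSemiring Γ) := ⟨mk (FinGSet.empty Γ)⟩

instance : One (BurnsideSemiring Γ) := ⟨mk (FinGSet.point Γ)⟩

instance : Add (BurnsideSemiring Γ) :=
  ⟨Quotient.map₂ FinGSet.sum fun _ _ h _ _ h' => FinGSet.sum_congr h h'⟩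

instance : Mul (BurnsideSemiring Γ) :=
  ⟨Quotient.map₂ FinGSet.prod fun _ _ h _ _ h' => FinGSet.prod_congr h h'⟩

instance : CommSemiring (BurnsideSemiring Γ) where
  nsmul := nsmulRec
  npow := npowRec
  add_assoc := by
    rintro ⟨X⟩ ⟨Y⟩ ⟨Z⟩
    refine sound ⟨Equiv.sumAssoc _ _ _, ?_⟩
    rintro g ((x | y) | z) <;> rfl
  zero_add := by
    rintro ⟨X⟩
    refine sound ⟨Equiv.emptySum PEmpty X.carrier, ?_⟩
    rintro g (x | x)
    · cases x
    · rfl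
  add_zero := by
    rintro ⟨X⟩
    refine sound ⟨Equiv.sumEmpty X.carrier PEmpty, ?_⟩
    rintro g (x | x)
    · rfl
    · cases x
  add_comm := by
    rintro ⟨X⟩ ⟨Y⟩
    refine sound ⟨Equiv.sumComm _ _, ?_⟩
    rintro g (x | y) <;> rfl
  mul_assoc := by
    rintro ⟨X⟩ ⟨Y⟩ ⟨Z⟩
    exact sound ⟨Equiv.prodAssoc _ _ _, fun _ _ => rfl⟩
  one_mul := by
    rintro ⟨X⟩
    exact sound ⟨Equiv.punitProd _, fun _ _ => rfl⟩
  mul_one := by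
    rintro ⟨X⟩
    exact sound ⟨Equiv.prodPUnit _, fun _ _ => rfl⟩
  mul_comm := by
    rintro ⟨X⟩ ⟨Y⟩
    exact sound ⟨Equiv.prodComm _ _, fun _ _ => rfl⟩
  zero_mul := by
    rintro ⟨X⟩
    exact sound ⟨Equiv.pemptyProd _, fun g x => x.1.elim⟩
  mul_zero := by
    rintro ⟨X⟩
    exact sound ⟨Equiv.prodPEmpty _, fun g x => x.2.elim⟩
  left_distrib := by
    rintro ⟨X⟩ ⟨Y⟩ ⟨Z⟩
    refine sound ⟨Equiv.prodSumDistrib _ _ _, ?_⟩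
    rintro g ⟨x, y | z⟩ <;> rfl
  right_distrib := by
    rintro ⟨X⟩ ⟨Y⟩ ⟨Z⟩
    refine sound ⟨Equiv.sumProdDistrib _ _ _, ?_⟩
    rintro g ⟨x | y, z⟩ <;> rfl

theorem mk_sum (X Y : FinGSet Γ) : mk (X.sum Y) = mk X + mk Y := rfl

/-- Letting `Γ` act through `f : Γ → Δ`, on isomorphism classes. -/
def pullback (f : Γ →* Δ) : BurnsideSemiring Δ →+* BurnsideSemiring Γ where
  toFun := Quotient.map (FinGSet.pullback f) fun _ _ h => FinGSet.pullback_congr f h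
  map_zero' := sound ⟨Equiv.refl _, fun _ x => x.elim⟩
  map_one' := sound ⟨Equiv.refl _, fun _ _ => rfl⟩
  map_add' := by
    rintro ⟨X⟩ ⟨Y⟩
    refine sound ⟨Equiv.refl _, ?_⟩
    rintro g (x | y) <;> rfl
  map_mul' := by
    rintro ⟨X⟩ ⟨Y⟩
    exact sound ⟨Equiv.refl _, fun _ _ => rfl⟩

/-- `X ↦ Δ ×_Γ X` on isomorphism classes. -/
def induce [Finite Δ] (f : Γ →* Δ) : BurnsideSemiring Γ →+ BurnsideSemiring Δ where
  toFun := Quotient.map (FinGSet.induce f) fun _ _ h => FinGSet.induce_congr f h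
  map_zero' := by
    have : IsEmpty (FinGSet.induce f (FinGSet.empty Γ)).carrier :=
      ⟨fun x => Quotient.inductionOn x fun a => a.2.elim⟩
    have : IsEmpty (FinGSet.empty Δ).carrier := ⟨fun x => x.elim⟩
    exact sound ⟨Equiv.equivOfIsEmpty _ _, fun _ x => isEmptyElim x⟩
  map_add' := by
    rintro ⟨X⟩ ⟨Y⟩
    exact sound (FinGSet.induce_sum f X Y)

/-- `X ↦ Map_Γ(Δ, X)` on isomorphism classes. -/
def coinduce [Finite Δ] (f : Γ →* Δ) : BurnsideSemiring Γ → BurnsideSemiring Δ :=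
  Quotient.map (FinGSet.coinduce f) fun _ _ h => FinGSet.coinduce_congr f h

/-- The number of `I`-fixed points, as a semiring homomorphism. -/
noncomputable def mark (I : Subgroup Γ) : BurnsideSemiring Γ →+* ℕ where
  toFun := Quotient.lift (FinGSet.fixedCard I) fun _ _ h => FinGSet.fixedCard_congr I h
  map_zero' := by
    have : IsEmpty (FinGSet.empty Γ).carrier := ⟨fun x => x.elim⟩
    exact Nat.card_of_isEmpty (α := {x : (FinGSet.empty Γ).carrier // ∀ i ∈ I, i • x = x})
  map_one' := by
    have : Unique {x : (FinGSet.point Γ).carrier // ∀ i ∈ I, i • x = x} :=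
      ⟨⟨⟨PUnit.unit, fun _ _ => rfl⟩⟩, fun _ => rfl⟩
    exact Nat.card_unique (α := {x : (FinGSet.point Γ).carrier // ∀ i ∈ I, i • x = x})
  map_add' := by
    rintro ⟨X⟩ ⟨Y⟩
    change Nat.card {x : X.carrier ⊕ Y.carrier // ∀ i ∈ I, i • x = x} =
      Nat.card {x : X.carrier // ∀ i ∈ I, i • x = x} +
        Nat.card {x : Y.carrier // ∀ i ∈ I, i • x = x}
    rw [← Nat.card_sum]
    refine Nat.card_congr (Equiv.trans Equiv.subtypeSum (Equiv.sumCongr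
      (Equiv.subtypeEquivRight fun x => ?_) (Equiv.subtypeEquivRight fun x => ?_)))
    · simp
    · simp
  map_mul' := by
    rintro ⟨X⟩ ⟨Y⟩
    change Nat.card {x : X.carrier × Y.carrier // ∀ i ∈ I, i • x = x} =
      Nat.card {x : X.carrier // ∀ i ∈ I, i • x = x} *
        Nat.card {x : Y.carrier // ∀ i ∈ I, i • x = x}
    rw [← Nat.card_prod]
    refine Nat.card_congr (Equiv.trans (Equiv.subtypeEquivRight fun x => ?_)
      (Equiv.subtypeProdEquivProd (p := fun x : X.carrier => ∀ i ∈ I, i • x = x)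
        (q := fun y : Y.carrier => ∀ i ∈ I, i • y = y)))
    simp [Prod.ext_iff, forall_and]

end BurnsideSemiring

/-! ### Isomorphism classes are determined by fixed point counts -/

namespace FinGSet

variable {Γ Δ : Type u} [Group Γ] [Group Δ]

/-- The complement of an orbit. -/
def compl (X : FinGSet Γ) (x : X.carrier) : FinGSet Γ where
  carrier := {z : X.carrier // z ∉ MulAction.orbit Γ x}
  action :=
    { smul := fun g z => ⟨g • z.1, fun h => z.2 (by
        have := MulAction.mem_orbit_of_mem_orbit g⁻¹ h
        rwa [inv_smul_smul] at this)⟩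
      one_smul := fun z => Subtype.ext (one_smul Γ z.1)
      mul_smul := fun g h z => Subtype.ext (mul_smul g h z.1) }
  finite := inferInstance

theorem iso_coset_sum_compl [Finite Γ] (X : FinGSet Γ) (x : X.carrier) :
    Iso (sum (coset (MulAction.stabilizer Γ x)) (X.compl x)) X := by
  classical
  refine ⟨((MulAction.orbitEquivQuotientStabilizer Γ x).symm.sumCongr
    (Equiv.refl {z : X.carrier // z ∉ MulAction.orbit Γ x})).trans
      (Equiv.sumCompl (fun z => z ∈ MulAction.orbit Γ x)), ?_⟩
  rintro g (q | z)
  · obtain ⟨h, rfl⟩ := QuotientGroup.mk_surjective q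
    change ((MulAction.orbitEquivQuotientStabilizer Γ x).symm ((g * (h : Γ) : Γ) : Γ ⧸ _) : X.carrier) =
      g • ((MulAction.orbitEquivQuotientStabilizer Γ x).symm (h : Γ ⧸ _) : X.carrier)
    rw [MulAction.orbitEquivQuotientStabilizer_symm_apply,
      MulAction.orbitEquivQuotientStabilizer_symm_apply, mul_smul]
  · rfl

theorem card_compl_lt (X : FinGSet Γ) (x : X.carrier) :
    Nat.card (X.compl x).carrier < Nat.card X.carrier :=
  Finite.card_subtype_lt (p := fun z => z ∉ MulAction.orbit Γ x) (x := x)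
    (fun h => h (MulAction.mem_orbit_self x))

theorem fixedCard_pos_iff (I : Subgroup Γ) (X : FinGSet Γ) :
    0 < fixedCard I X ↔ ∃ x : X.carrier, I ≤ MulAction.stabilizer Γ x := by
  rw [fixedCard, Nat.card_pos_iff]
  constructor
  · rintro ⟨⟨x, hx⟩, -⟩
    exact ⟨x, hx⟩
  · rintro ⟨x, hx⟩
    exact ⟨⟨x, fun i hi => hx hi⟩, inferInstance⟩

end FinGSet

namespace BurnsideSemiring

variable {Γ Δ : Type u} [Group Γ] [Group Δ]

theorem mark_mk (I : Subgroup Γ) (X : FinGSet Γ) : mark I (mk X) = X.fixedCard I := rfl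

/-- Two finite `Γ`-sets with the same number of fixed points for each subgroup are isomorphic. -/
theorem eq_of_mark_eq [Finite Γ] {a b : BurnsideSemiring Γ} (h : ∀ I, mark I a = mark I b) :
    a = b := by
  obtain ⟨X, rfl⟩ : ∃ X, a = mk X := ⟨a.out, (Quotient.out_eq a).symm⟩
  obtain ⟨Y, rfl⟩ : ∃ Y, b = mk Y := ⟨b.out, (Quotient.out_eq b).symm⟩
  induction hn : Nat.card X.carrier using Nat.strong_induction_on generalizing X Y with
  | _ n ih =>
  subst hn
  rcases isEmpty_or_nonempty X.carrier with hX | hX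
  · have hY : IsEmpty Y.carrier := by
      by_contra hY
      rw [not_isEmpty_iff] at hY
      obtain ⟨y⟩ := hY
      have h1 := (FinGSet.fixedCard_pos_iff ⊥ Y).2 ⟨y, bot_le⟩
      rw [← mark_mk, ← h, mark_mk, FinGSet.fixedCard_pos_iff] at h1
      exact hX.elim h1.choose
    exact sound ⟨Equiv.equivOfIsEmpty _ _, fun _ x => isEmptyElim x⟩
  · obtain ⟨x, hx⟩ := Finite.exists_max
      (fun x : X.carrier => Nat.card (MulAction.stabilizer Γ x))
    obtain ⟨y, hy⟩ : ∃ y : Y.carrier, MulAction.stabilizer Γ x ≤ MulAction.stabilizer Γ y := by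
      rw [← FinGSet.fixedCard_pos_iff, ← mark_mk, ← h, mark_mk, FinGSet.fixedCard_pos_iff]
      exact ⟨x, le_rfl⟩
    obtain ⟨z, hz⟩ : ∃ z : X.carrier, MulAction.stabilizer Γ y ≤ MulAction.stabilizer Γ z := by
      rw [← FinGSet.fixedCard_pos_iff, ← mark_mk, h, mark_mk, FinGSet.fixedCard_pos_iff]
      exact ⟨y, le_rfl⟩
    have hxy : MulAction.stabilizer Γ x = MulAction.stabilizer Γ y :=
      Subgroup.eq_of_le_of_card_ge hy ((Subgroup.card_le_of_le hz).trans (hx z))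
    have hX' := sound (FinGSet.iso_coset_sum_compl X x)
    have hY' := sound (FinGSet.iso_coset_sum_compl Y y)
    rw [mk_sum] at hX' hY'
    rw [← hxy] at hY'
    rw [← hX', ← hY']
    congr 1
    refine ih _ (X.card_compl_lt x) _ _ (fun I => ?_) rfl
    have := h I
    rw [← hX', ← hY', map_add, map_add] at this
    exact Nat.add_left_cancel this

/-- The fixed points of a coinduced set are a product of fixed point sets, with at most `|Δ|`
factors. -/
theorem exists_mark_coinduce [Finite Δ] (f : Γ →* Δ) (I : Subgroup Δ) :
    ∃ (n : ℕ) (S : Fin n → Subgroup Γ), n ≤ Nat.card Δ ∧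
      ∀ a, mark I (coinduce f a) = ∏ c, mark (S c) a := by
  classical
  let s : Setoid Δ :=
    { r := fun d e => ∃ γ : Γ, ∃ i ∈ I, e = f γ * d * i
      iseqv :=
        { refl := fun d => ⟨1, 1, I.one_mem, by simp⟩
          symm := by
            rintro d e ⟨γ, i, hi, rfl⟩
            exact ⟨γ⁻¹, i⁻¹, I.inv_mem hi, by simp [mul_assoc]⟩
          trans := by
            rintro d e g ⟨γ, i, hi, rfl⟩ ⟨γ', i', hi', rfl⟩
            exact ⟨γ' * γ, i * i', I.mul_mem hi hi', by simp [mul_assoc]⟩ } }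
  let T : Quotient s → Subgroup Γ := fun c =>
    (I.map (MulAut.conj c.out).toMonoidHom).comap f
  have hT : ∀ c γ, γ ∈ T c ↔ ∃ i ∈ I, f γ * c.out = c.out * i := by
    intro c γ
    simp only [T, Subgroup.mem_comap, Subgroup.mem_map]
    refine exists_congr fun i => and_congr_right fun _ => ?_
    simp only [MulEquiv.coe_toMonoidHom, MulAut.conj_apply]
    rw [mul_inv_eq_iff_eq_mul, eq_comm]
  have hd : ∀ d : Δ, ∃ γ : Γ, ∃ i ∈ I, d = f γ * (Quotient.mk s d).out * i := fun d =>
    Quotient.exact (Quotient.out_eq (Quotient.mk s d))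
  have : Finite (Quotient s) := Quotient.finite s
  have : Fintype (Quotient s) := Fintype.ofFinite _
  refine ⟨Nat.card (Quotient s), fun k => T ((Finite.equivFin (Quotient s)).symm k),
    Nat.card_le_card_of_surjective (Quotient.mk s) Quotient.mk_surjective, ?_⟩
  rintro ⟨X⟩
  rw [Equiv.prod_comp (Finite.equivFin (Quotient s)).symm (fun c => mark (T c) (Quot.mk _ X))]
  change Nat.card {φ : (FinGSet.coinduce f X).carrier // ∀ i ∈ I, i • φ = φ} =
      ∏ c, Nat.card {x : X.carrier // ∀ γ ∈ T c, γ • x = x}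
  rw [← Nat.card_pi]
  refine Nat.card_congr (Equiv.ofBijective
    (fun φ c => ⟨φ.1.1 c.out, fun γ hγ => ?_⟩) ⟨?_, ?_⟩)
  · obtain ⟨i, hi, h⟩ := (hT c γ).1 hγ
    rw [← φ.1.2, h]
    exact congrFun (congrArg Subtype.val (φ.2 i hi)) c.out
  · intro φ ψ h
    refine Subtype.ext (Subtype.ext (funext fun d => ?_))
    obtain ⟨γ, i, hi, hdi⟩ := hd d
    have h1 : φ.1.1 (Quotient.mk s d).out = ψ.1.1 (Quotient.mk s d).out :=
      congrArg Subtype.val (congrFun h (Quotient.mk s d))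
    have h2 : φ.1.1 ((Quotient.mk s d).out * i) = φ.1.1 (Quotient.mk s d).out :=
      congrFun (congrArg Subtype.val (φ.2 i hi)) _
    have h3 : ψ.1.1 ((Quotient.mk s d).out * i) = ψ.1.1 (Quotient.mk s d).out :=
      congrFun (congrArg Subtype.val (ψ.2 i hi)) _
    rw [hdi, mul_assoc, φ.1.2, ψ.1.2, h2, h3, h1]
  · intro x
    choose γ i hi hdi using hd
    have key : ∀ (d : Δ) (γ' : Γ) (i' : Δ), i' ∈ I →
        d = f γ' * (Quotient.mk s d).out * i' →
          γ d • (x (Quotient.mk s d)).1 = γ' • (x (Quotient.mk s d)).1 := by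
      intro d γ' i' hi' h
      have h1 : γ'⁻¹ * γ d ∈ T (Quotient.mk s d) := by
        rw [hT]
        refine ⟨i' * (i d)⁻¹, I.mul_mem hi' (I.inv_mem (hi d)), ?_⟩
        have h2 := (hdi d).symm.trans h
        rw [map_mul, map_inv, mul_assoc, inv_mul_eq_iff_eq_mul, ← mul_assoc, ← mul_assoc, ← h2]
        simp [mul_assoc]
      have h3 := (x (Quotient.mk s d)).2 _ h1
      rwa [mul_smul, inv_smul_eq_iff] at h3
    have hmk : ∀ (d : Δ) (γ' : Γ) (i' : Δ), i' ∈ I →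
        Quotient.mk s (f γ' * d * i') = Quotient.mk s d := fun d γ' i' hi' =>
      (Quotient.sound (show s.r d (f γ' * d * i') from ⟨γ', i', hi', rfl⟩)).symm
    have hval : ∀ (d : Δ) (γ' : Γ) (i' : Δ), i' ∈ I →
        γ (f γ' * d * i') • (x (Quotient.mk s (f γ' * d * i'))).1 =
          γ' • γ d • (x (Quotient.mk s d)).1 := by
      intro d γ' i' hi'
      rw [key (f γ' * d * i') (γ' * γ d) (i d * i') (I.mul_mem (hi d) hi')]
      · rw [hmk d γ' i' hi', mul_smul]
      · rw [hmk d γ' i' hi']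
        conv_lhs => rw [hdi d]
        simp [mul_assoc]
    refine ⟨⟨⟨fun d => γ d • (x (Quotient.mk s d)).1, fun γ' d => ?_⟩, fun j hj => ?_⟩, ?_⟩
    · have := hval d γ' 1 I.one_mem
      rw [mul_one] at this
      exact this
    · refine Subtype.ext (funext fun d => ?_)
      have := hval d 1 j hj
      rw [show f 1 * d * j = d * j by simp, one_smul] at this
      exact this
    · funext c
      refine Subtype.ext ?_
      have h1 := key c.out 1 1 I.one_mem (by simp)
      rw [one_smul] at h1
      exact h1.trans (by rw [Quotient.out_eq])

end BurnsideSemiring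

/-! ### The Burnside ring and its structure maps -/

/-- The Burnside ring `A(Γ)`: the Grothendieck ring of the semiring of finite `Γ`-sets. -/
def BurnsideRing (Γ : Type u) [Group Γ] : Type (u + 1) := GrothendieckRing (BurnsideSemiring Γ)

namespace BurnsideRing

variable {Γ Δ : Type u} [Group Γ] [Group Δ]

noncomputable instance : CommRing (BurnsideRing Γ) :=
  inferInstanceAs (CommRing (GrothendieckRing (BurnsideSemiring Γ)))

/-- The class in `A(Γ)` of an element of the semiring of finite `Γ`-sets. -/
noncomputable def ofSemiring : BurnsideSemiring Γ →+* BurnsideRing Γ :=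
  GrothendieckRing.of _

/-- The class `[X]` in `A(Γ)` of a finite `Γ`-set `X`. -/
noncomputable def of (X : FinGSet Γ) : BurnsideRing Γ := ofSemiring (BurnsideSemiring.mk X)

theorem exists_eq_sub (x : BurnsideRing Γ) :
    ∃ a b : BurnsideSemiring Γ, x = ofSemiring a - ofSemiring b :=
  GrothendieckRing.exists_eq_of_sub_of x

/-- The ring homomorphism `A(Δ) → A(Γ)` letting `Γ` act on `Δ`-sets through `f : Γ → Δ`. -/
noncomputable def pullback (f : Γ →* Δ) : BurnsideRing Δ →+* BurnsideRing Γ :=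
  GrothendieckRing.lift (ofSemiring.comp (BurnsideSemiring.pullback f))

theorem pullback_of (f : Γ →* Δ) (X : FinGSet Δ) : pullback f (of X) = of (X.pullback f) :=
  GrothendieckRing.lift_of _ _

/-- The additive extension of `X ↦ Δ ×_Γ X`. -/
noncomputable def induce [Finite Δ] (f : Γ →* Δ) : BurnsideRing Γ →+ BurnsideRing Δ :=
  GrothendieckRing.liftAdd
    ((ofSemiring : BurnsideSemiring Δ →+* BurnsideRing Δ).toAddMonoidHom.comp
      (BurnsideSemiring.induce f))

theorem induce_of [Finite Δ] (f : Γ →* Δ) (X : FinGSet Γ) :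
    induce f (of X) = of (X.induce f) :=
  GrothendieckRing.liftAdd_ofAdd _ _

/-- The mark homomorphism `φ^I : A(Γ) → ℤ`, `[X] ↦ |X^I|`. -/
noncomputable def mark (I : Subgroup Γ) : BurnsideRing Γ →+* ℤ :=
  GrothendieckRing.lift ((Nat.castRingHom ℤ).comp (BurnsideSemiring.mark I))

theorem mark_ofSemiring (I : Subgroup Γ) (a : BurnsideSemiring Γ) :
    mark I (ofSemiring a) = BurnsideSemiring.mark I a :=
  GrothendieckRing.lift_of _ _

theorem mark_of (I : Subgroup Γ) (X : FinGSet Γ) : mark I (of X) = X.fixedCard I :=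
  GrothendieckRing.lift_of _ _

/-- The marks jointly detect equality. -/
theorem eq_of_mark_eq [Finite Γ] {x y : BurnsideRing Γ} (h : ∀ I, mark I x = mark I y) :
    x = y := by
  obtain ⟨a, b, rfl⟩ := exists_eq_sub x
  obtain ⟨c, d, rfl⟩ := exists_eq_sub y
  rw [sub_eq_sub_iff_add_eq_add, ← map_add, ← map_add]
  congr 1
  refine BurnsideSemiring.eq_of_mark_eq fun I => ?_
  have := h I
  simp only [map_sub, mark_ofSemiring] at this
  rw [map_add, map_add]
  omega

/-- The extrapolated value at `a - b` of the map `X ↦ [Map_Γ(Δ, X)]`. This map is polynomial of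
degree at most `n = |Δ|`, so the `(n + 1)`-st finite difference of `k ↦ [Map_Γ(Δ, a + k b)]`
vanishes for any polynomial extension to virtual sets, and the value at `k = -1` is determined
by the values at `k = 0, …, n`. -/
noncomputable def normPair [Finite Δ] (f : Γ →* Δ) (a b : BurnsideSemiring Γ) :
    BurnsideRing Δ :=
  ∑ k ∈ Finset.range (Nat.card Δ + 1),
    ((-1 : ℤ) ^ k * ((Nat.card Δ + 1).choose (k + 1) : ℤ)) •
      ofSemiring (BurnsideSemiring.coinduce f (a + k • b))

theorem extrapolate (n m : ℕ) (h : m ≤ n) (α β : Fin m → ℤ) :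
    ∑ k ∈ Finset.range (n + 1),
      ((-1 : ℤ) ^ k * ((n + 1).choose (k + 1) : ℤ)) * ∏ c, (α c + k * β c) =
        ∏ c, (α c - β c) := by
  let P : Polynomial ℤ := ∏ c, (Polynomial.C (α c) + Polynomial.X * Polynomial.C (β c))
  have hP : ∀ t, P.eval t = ∏ c, (α c + t * β c) := by
    intro t
    simp [P, Polynomial.eval_prod]
  have hdeg : P.natDegree < n + 1 := by
    refine Nat.lt_succ_of_le (le_trans (Polynomial.natDegree_prod_le _ _) (le_trans
      (Finset.sum_le_card_nsmul _ _ 1 fun c _ => ?_) (by simpa using h)))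
    refine (Polynomial.natDegree_add_le _ _).trans (max_le (by simp) ?_)
    exact (Polynomial.natDegree_mul_C_le _ _).trans Polynomial.natDegree_X_le
  have h0 := congrFun (Polynomial.fwdDiff_iter_eq_zero_of_degree_lt hdeg) (-1)
  rw [fwdDiff_iter_eq_sum_shift, Finset.sum_range_succ'] at h0
  simp only [hP, Pi.zero_apply, smul_eq_mul, nsmul_eq_mul, mul_one] at h0
  have h1 : ∏ c, (α c + (-1 + ((0 : ℕ) : ℤ)) * β c) = ∏ c, (α c - β c) :=
    Finset.prod_congr rfl fun c _ => by push_cast; ring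
  rw [h1] at h0
  have h2 : ∑ k ∈ Finset.range (n + 1),
      ((-1 : ℤ) ^ (n + 1 - (k + 1)) * ((n + 1).choose (k + 1) : ℤ)) *
        ∏ c, (α c + (-1 + ((k + 1 : ℕ) : ℤ)) * β c) =
      (-1) ^ n * ∑ k ∈ Finset.range (n + 1),
        ((-1 : ℤ) ^ k * ((n + 1).choose (k + 1) : ℤ)) * ∏ c, (α c + k * β c) := by
    rw [Finset.mul_sum]
    refine Finset.sum_congr rfl fun k hk => ?_
    have hk' : k ≤ n := Nat.lt_succ_iff.1 (Finset.mem_range.1 hk)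
    have h3 : (-1 : ℤ) ^ (n + 1 - (k + 1)) = (-1) ^ n * (-1) ^ k := by
      rw [Nat.add_sub_add_right]
      have h4 : (-1 : ℤ) ^ k * (-1) ^ k = 1 := by rw [← mul_pow]; simp
      have h5 : (-1 : ℤ) ^ n = (-1) ^ (n - k) * (-1) ^ k := by
        rw [← pow_add, Nat.sub_add_cancel hk']
      rw [h5, mul_assoc, h4, mul_one]
    have h6 : ∏ c, (α c + (-1 + ((k + 1 : ℕ) : ℤ)) * β c) = ∏ c, (α c + k * β c) :=
      Finset.prod_congr rfl fun c _ => by push_cast; ring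
    rw [h3, h6]
    ring
  rw [h2] at h0
  have h7 : (-1 : ℤ) ^ n * (-1) ^ n = 1 := by rw [← mul_pow]; simp
  simp only [Nat.sub_zero, Nat.choose_zero_right, Nat.cast_one, mul_one, pow_succ] at h0
  linear_combination (-1) ^ n * h0 - (∑ k ∈ Finset.range (n + 1),
    ((-1 : ℤ) ^ k * ((n + 1).choose (k + 1) : ℤ)) * ∏ c, (α c + k * β c) -
      ∏ c, (α c - β c)) * h7

theorem mark_normPair [Finite Δ] (f : Γ →* Δ) (I : Subgroup Δ) :
    ∃ (n : ℕ) (S : Fin n → Subgroup Γ),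
      (∀ a, mark I (ofSemiring (BurnsideSemiring.coinduce f a)) =
        ∏ c, mark (S c) (ofSemiring a)) ∧
      ∀ a b, mark I (normPair f a b) = ∏ c, mark (S c) (ofSemiring a - ofSemiring b) := by
  obtain ⟨n, S, hn, hS⟩ := BurnsideSemiring.exists_mark_coinduce f I
  refine ⟨n, S, fun a => ?_, fun a b => ?_⟩
  · simp only [mark_ofSemiring, hS, Nat.cast_prod]
  simp only [map_sub, mark_ofSemiring]
  rw [← extrapolate _ _ hn, normPair, map_sum]
  refine Finset.sum_congr rfl fun k _ => ?_
  rw [map_zsmul, mark_ofSemiring, hS, smul_eq_mul]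
  congr 1
  push_cast
  exact Finset.prod_congr rfl fun c _ => by simp

theorem normPair_eq [Finite Δ] (f : Γ →* Δ) {a b c d : BurnsideSemiring Γ}
    (h : ofSemiring a - ofSemiring b = ofSemiring c - ofSemiring d) :
    normPair f a b = normPair f c d := by
  refine eq_of_mark_eq fun I => ?_
  obtain ⟨n, S, -, hS⟩ := mark_normPair f I
  rw [hS, hS, h]

/-- The extension of `X ↦ Map_Γ(Δ, X)` to a map `A(Γ) → A(Δ)`, given on formal differences by
polynomial extrapolation. -/
noncomputable def coinduce [Finite Δ] (f : Γ →* Δ) (x : BurnsideRing Γ) : BurnsideRing Δ :=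
  AddLocalization.liftOn (S := (⊤ : AddSubmonoid (BurnsideSemiring Γ))) x
    (fun a b => normPair f a b) fun {a c b d} h => normPair_eq f (by
      have h1 := AddLocalization.mk_eq_mk_iff.2 h
      have h2 := GrothendieckRing.mk_eq a b.1
      have h3 := GrothendieckRing.mk_eq c d.1
      exact (h2.symm.trans h1).trans h3)

theorem coinduce_sub [Finite Δ] (f : Γ →* Δ) (a b : BurnsideSemiring Γ) :
    coinduce f (ofSemiring a - ofSemiring b) = normPair f a b := by
  have h : (ofSemiring a - ofSemiring b : BurnsideRing Γ) =
      (AddLocalization.mk a ⟨b, trivial⟩ : Algebra.GrothendieckAddGroup (BurnsideSemiring Γ)) :=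
    (GrothendieckRing.mk_eq a b).symm
  rw [h]
  rfl

/-- On actual finite `Γ`-sets the map is `[X] ↦ [Map_Γ(Δ, X)]`. -/
theorem coinduce_of [Finite Δ] (f : Γ →* Δ) (X : FinGSet Γ) :
    coinduce f (of X) = of (X.coinduce f) := by
  refine eq_of_mark_eq fun I => ?_
  obtain ⟨n, S, h₁, h₂⟩ := mark_normPair f I
  have h := coinduce_sub f (BurnsideSemiring.mk X) 0
  rw [map_zero, sub_zero] at h
  rw [of, h, h₂, map_zero, sub_zero, ← h₁]
  rfl

/-- The extension is multiplicative. -/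
theorem coinduce_mul [Finite Δ] (f : Γ →* Δ) (x y : BurnsideRing Γ) :
    coinduce f (x * y) = coinduce f x * coinduce f y := by
  refine eq_of_mark_eq fun I => ?_
  obtain ⟨n, S, -, h⟩ := mark_normPair f I
  have key : ∀ z, mark I (coinduce f z) = ∏ c, mark (S c) z := by
    intro z
    obtain ⟨a, b, rfl⟩ := exists_eq_sub z
    rw [coinduce_sub, h]
  rw [map_mul, key, key, key, ← Finset.prod_mul_distrib]
  exact Finset.prod_congr rfl fun c _ => map_mul _ _ _

end BurnsideRing

/-! ### The Burnside Tambara functor and its ideals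

The value at the orbit `G/H` is the Burnside ring `A(H)`. -/

/-- The conjugate `H^g = g⁻¹ H g`. -/
def conjSubgroup {G : Type u} [Group G] (H : Subgroup G) (g : G) : Subgroup G :=
  H.map (MulAut.conj g⁻¹).toMonoidHom

/-- The homomorphism `H^g → H`, `y ↦ g y g⁻¹`. -/
def conjHom {G : Type u} [Group G] (H : Subgroup G) (g : G) : conjSubgroup H g →* H :=
  ((MulAut.conj g).toMonoidHom.comp (conjSubgroup H g).subtype).codRestrict H (by
    rintro ⟨_, x, hx, rfl⟩
    simpa [mul_assoc] using hx)

namespace BurnsideTambara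

variable {G : Type u} [Group G]

/-- Restriction `A(H) → A(K)` for `K ≤ H`. -/
noncomputable def res {K H : Subgroup G} (h : K ≤ H) : BurnsideRing H →+* BurnsideRing K :=
  BurnsideRing.pullback (Subgroup.inclusion h)

/-- Transfer `A(K) → A(H)`, `X ↦ H ×_K X`, for `K ≤ H`. -/
noncomputable def tr [Finite G] {K H : Subgroup G} (h : K ≤ H) :
    BurnsideRing K →+ BurnsideRing H :=
  BurnsideRing.induce (Subgroup.inclusion h)

/-- Norm `A(K) → A(H)`, extending `X ↦ Map_K(H, X)`, for `K ≤ H`. -/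
noncomputable def norm [Finite G] {K H : Subgroup G} (h : K ≤ H) :
    BurnsideRing K → BurnsideRing H :=
  BurnsideRing.coinduce (Subgroup.inclusion h)

/-- Conjugation `A(H) → A(H^g)`. -/
noncomputable def conj (g : G) (H : Subgroup G) :
    BurnsideRing H →+* BurnsideRing (conjSubgroup H g) :=
  BurnsideRing.pullback (conjHom H g)

end BurnsideTambara

/-- An ideal of the Burnside Tambara functor of `G`. -/
structure TambaraIdeal (G : Type u) [Group G] [Finite G] where
  /-- The value at the orbit `G/H`. -/
  level : ∀ H : Subgroup G, Ideal (BurnsideRing H)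
  res_mem : ∀ {K H : Subgroup G} (h : K ≤ H), ∀ x ∈ level H, BurnsideTambara.res h x ∈ level K
  tr_mem : ∀ {K H : Subgroup G} (h : K ≤ H), ∀ x ∈ level K, BurnsideTambara.tr h x ∈ level H
  norm_mem : ∀ {K H : Subgroup G} (h : K ≤ H), ∀ x ∈ level K,
    ∃ y ∈ level H, BurnsideTambara.norm h x = y + BurnsideTambara.norm h 0
  conj_mem : ∀ (g : G) (H : Subgroup G), ∀ x ∈ level H,
    BurnsideTambara.conj g H x ∈ level (conjSubgroup H g)

namespace TambaraIdeal

variable {G : Type u} [Group G] [Finite G]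

/-- The value at `G/H` of the product of two ideals: the elements `f_+(ab)` for `f : A → G/H` a map
of finite `G`-sets, `a ∈ I(A)` and `b ∈ J(A)`. Over `G/H` such an `A` is a finite disjoint union of
orbits `G/Kᵢ` with `Kᵢ ≤ H` and quotient maps `G/Kᵢ → G/H`, so that `a` and `b` are families of
elements `aᵢ ∈ I(G/Kᵢ)`, `bᵢ ∈ J(G/Kᵢ)` and `f_+` is the sum of the transfers. -/
def mulLevel (I J : TambaraIdeal G) (H : Subgroup G) : Set (BurnsideRing H) :=
  {x | ∃ (n : ℕ) (K : Fin n → Subgroup G) (hK : ∀ i, K i ≤ H)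
    (a b : ∀ i, BurnsideRing (K i)), (∀ i, a i ∈ I.level (K i)) ∧ (∀ i, b i ∈ J.level (K i)) ∧
      x = ∑ i, BurnsideTambara.tr (hK i) (a i * b i)}

/-- A proper ideal `P` is prime if `I J ⊆ P` implies `I ⊆ P` or `J ⊆ P`. -/
def IsPrime (P : TambaraIdeal G) : Prop :=
  (∃ H, P.level H ≠ ⊤) ∧
    ∀ I J : TambaraIdeal G, (∀ H, mulLevel I J H ⊆ (P.level H : Set (BurnsideRing H))) →
      (∀ H, I.level H ≤ P.level H) ∨ (∀ H, J.level H ≤ P.level H)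

/-- `P` lies over `q` if its value at `G/e` is the ideal `(q)` of `A(e) = ℤ`. -/
def IsOver (P : TambaraIdeal G) (q : ℕ) : Prop :=
  P.level ⊥ = Ideal.span {(q : BurnsideRing (⊥ : Subgroup G))}

/-- The restriction of `P` to the Burnside Tambara functor of a subgroup `S`. Its value at `S/K` is
`P(G/K)`, under the identification of `K` as a subgroup of `S` with its image in `G`. -/
noncomputable def restrict (P : TambaraIdeal G) (S : Subgroup G) (K : Subgroup S) :
    Ideal (BurnsideRing K) :=
  (P.level (K.map S.subtype)).comap (BurnsideRing.pullback
    (K.equivMapOfInjective S.subtype S.subtype_injective).symm.toMonoidHom)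

end TambaraIdeal

/-- The family `𝔭_{C,q}`: its value at `G/H` is the intersection of the kernels of the mark
homomorphisms `φ^I` modulo `q`, over the subgroups `I ≤ H` some conjugate of which lies in `C`. -/
noncomputable def burnsidePrime {G : Type u} [Group G] (C : Subgroup G) (q : ℕ)
    (H : Subgroup G) : Ideal (BurnsideRing H) :=
  ⨅ I : {I : Subgroup H // ∃ g : G, conjSubgroup (I.map H.subtype) g ≤ C},
    RingHom.ker ((Int.castRingHom (ZMod q)).comp (BurnsideRing.mark I.1))

/-- A Sylow `p`-subgroup of `C`, as a subgroup of `G`; the only one if `G` is abelian. -/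
noncomputable def sylowIn {G : Type u} [Group G] (p : ℕ) (C : Subgroup G) : Subgroup G :=
  ((default : Sylow p C) : Subgroup C).map C.subtype

/-! ### Subgroups of finite cyclic groups -/

/-! Everything is computed through marks, which are jointly injective. As `G` is abelian, transfers
multiply marks by an index or kill them, and norms raise them to a positive power. So for any
integer `a` the elements whose marks at subgroups of `C` are divisible by `a` form an ideal,
`markIdeal C a`, and 𝔭_{C,q} is the case `a = q`.

Suppose first that `C` contains the Sylow `q`-subgroup (no condition if `q = 0`). For `p ≠ q`, the
norm of `t_p - p` to `H` has mark a power of `-p` at those `I` whose order has larger `p`-part than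
that of `C`, and mark zero elsewhere. From it one gets an element of `P(G/H)` with constant mark
`m_p` there, `m_p` prime to `q` (nonzero if `q = 0`). The product `E` of the differences of `m_p`
and these elements is congruent modulo `P` to an integer `m` prime to `q`, and its marks vanish
outside the subgroups of `C`. If the marks of `x` on `C` are divisible by a large power of `q`, then
all marks of `E * x` are. The ghost ring modulo `A(H)` is killed by a power of `|H|`, and `P(G/H)`
contains a power of `q`, so an integer multiple of `x`, prime to `q`, lies in `P(G/H)`.

Thus `markIdeal C (q ^ k)` times `markIdeal ⊤ μ` lies in `P` for some `μ` prime to `q`. The second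
factor is not contained in `P`, since `μ` is not in `(q)` at `G/e`; primality gives the first, and
then `markIdeal C q`.

For general `C` and prime `q`, marks modulo `q` ignore the `q`-part of a subgroup, so `C` may be
enlarged by the Sylow `q`-subgroup. Part 2 reduces to part 1 because `t_p - p` has zero marks on
`Syl_p(C)`. -/

namespace IsCyclic

variable {Γ : Type u} [Group Γ] [Finite Γ] [IsCyclic Γ]

/-- A cyclic group has at most `|K|` solutions of `x ^ |K| = 1`, so `K` is the whole solution set.
Later inclusions of subgroups are reduced by this to divisibility of orders. -/
theorem subgroup_le_of_card_dvd {H K : Subgroup Γ} (h : Nat.card H ∣ Nat.card K) : H ≤ K := by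
  classical
  have : Fintype Γ := Fintype.ofFinite Γ
  have hpow : ∀ (L : Subgroup Γ) (y : Γ), y ∈ L → y ^ Nat.card L = 1 := fun L y hy =>
    congrArg Subtype.val (pow_card_eq_one' (x := (⟨y, hy⟩ : L)))
  have hK : (K : Set Γ).toFinset = Finset.univ.filter fun a : Γ => a ^ Nat.card K = 1 := by
    refine Finset.eq_of_subset_of_card_le (fun x hx => ?_) ?_
    · have hx' : x ∈ K := by simpa using hx
      simpa using hpow K x hx'
    · refine (IsCyclic.card_pow_eq_one_le Nat.card_pos).trans ?_
      simp [Nat.card_eq_fintype_card]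
  intro x hx
  have h1 : x ∈ Finset.univ.filter fun a : Γ => a ^ Nat.card K = 1 := by
    obtain ⟨k, hk⟩ := h
    rw [Finset.mem_filter, hk, pow_mul, hpow H x hx, one_pow]
    exact ⟨Finset.mem_univ x, rfl⟩
  rw [← hK] at h1
  simpa using h1

theorem exists_subgroup_card_eq {d : ℕ} (hd : d ∣ Nat.card Γ) :
    ∃ K : Subgroup Γ, Nat.card K = d := by
  obtain ⟨g, hg⟩ := IsCyclic.exists_ofOrder_eq_natCard (α := Γ)
  obtain ⟨e, he⟩ := hd
  refine ⟨Subgroup.zpowers (g ^ e), ?_⟩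
  have hpos : 0 < Nat.card Γ := Nat.card_pos
  have he0 : e ≠ 0 := by rintro rfl; simp [he] at hpos
  rw [Nat.card_zpowers, orderOf_pow_of_dvd he0 (by rw [hg, he]; exact Dvd.intro_left _ rfl), hg, he,
    Nat.mul_div_cancel _ (Nat.pos_of_ne_zero he0)]

theorem conjSubgroup_eq {Γ : Type u} [Group Γ] [IsCyclic Γ] (H : Subgroup Γ) (g : Γ) : conjSubgroup H g = H := by
  ext x
  have h : ∀ y : Γ, g⁻¹ * y * g = y := fun y => by
    rw [mul_assoc, mul_comm' y g, inv_mul_cancel_left]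
  simp [conjSubgroup, h]

end IsCyclic

/-! ### Fixed points of the operations on finite sets with an action -/

namespace FinGSet

variable {Γ Δ : Type u} [Group Γ] [Group Δ]

theorem fixedCard_pullback (f : Γ →* Δ) (X : FinGSet Δ) (I : Subgroup Γ) :
    fixedCard I (X.pullback f) = fixedCard (I.map f) X := by
  refine Nat.card_congr (Equiv.subtypeEquivRight fun x => ?_)
  simp only [Subgroup.mem_map, forall_exists_index, and_imp, forall_apply_eq_imp_iff₂]
  exact Iff.rfl

theorem fixedCard_coset [Finite Γ] [IsMulCommutative Γ] (I K : Subgroup Γ) [Decidable (I ≤ K)] :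
    fixedCard I (coset K) = if I ≤ K then K.index else 0 := by
  have key : ∀ (i : Γ) (x : Γ ⧸ K), i • x = x ↔ i ∈ K := by
    intro i x
    obtain ⟨g, rfl⟩ := QuotientGroup.mk_surjective x
    change ((i * g : Γ) : Γ ⧸ K) = g ↔ _
    rw [eq_comm, QuotientGroup.eq, mul_comm' i g, inv_mul_cancel_left]
  change Nat.card {x : Γ ⧸ K // ∀ i ∈ I, i • x = x} = _
  simp only [key]
  split_ifs with h
  · exact Nat.card_congr (Equiv.subtypeUnivEquiv fun _ => h)
  · have : IsEmpty {x : Γ ⧸ K // ∀ i ∈ I, i ∈ K} := ⟨fun x => h x.2⟩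
    exact Nat.card_of_isEmpty

theorem induce_smul_eq_iff [Finite Δ] [IsMulCommutative Δ] (f : Γ →* Δ)
    (X : FinGSet Γ) (i d : Δ) (x : X.carrier) :
    (i • (show (induce f X).carrier from Quotient.mk (indSetoid f X) (d, x)) =
      Quotient.mk (indSetoid f X) (d, x)) ↔ ∃ γ, f γ = i ∧ γ • x = x := by
  refine Quotient.eq.trans ?_
  change (∃ γ, i * d = d * f γ ∧ x = γ • x) ↔ _
  refine exists_congr fun γ => and_congr ?_ eq_comm
  rw [mul_comm' i d, mul_left_cancel_iff, eq_comm]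

theorem fixedCard_induce_of_not_le [Finite Δ] [IsMulCommutative Δ] (f : Γ →* Δ)
    (X : FinGSet Γ) (I : Subgroup Δ) (hI : ¬ I ≤ f.range) :
    fixedCard I (induce f X) = 0 := by
  have : IsEmpty {x : (induce f X).carrier // ∀ i ∈ I, i • x = x} := by
    refine ⟨?_⟩
    rintro ⟨⟨d, x⟩, h⟩
    refine hI fun i hi => ?_
    obtain ⟨γ, h1, -⟩ := (induce_smul_eq_iff f X i d x).1 (h i hi)
    exact ⟨γ, h1⟩
  exact Nat.card_of_isEmpty

/-- By commutativity the class of `(d, x)` is fixed by `I` exactly when `x` is fixed by the preimage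
of `I`, whatever `d` is. Injectivity of `f` makes a coset representative together with `x` a normal
form. -/
theorem fixedCard_induce [Finite Δ] [IsMulCommutative Δ] (f : Γ →* Δ)
    (hf : Function.Injective f) (X : FinGSet Γ) (I : Subgroup Δ) (hI : I ≤ f.range) :
    fixedCard I (induce f X) = f.range.index * fixedCard (I.comap f) X := by
  rw [fixedCard, fixedCard, Subgroup.index, ← Nat.card_prod]
  refine (Nat.card_congr (Equiv.ofBijective
    (fun c : (Δ ⧸ f.range) × {x : X.carrier // ∀ i ∈ I.comap f, i • x = x} =>
      (⟨Quotient.mk (indSetoid f X) (c.1.out, c.2.1), fun i hi => ?_⟩ :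
        {x : (induce f X).carrier // ∀ i ∈ I, i • x = x})) ⟨?_, ?_⟩)).symm
  · obtain ⟨γ, rfl⟩ := hI hi
    exact (induce_smul_eq_iff f X _ _ _).2 ⟨γ, rfl, c.2.2 γ hi⟩
  · rintro ⟨c, x⟩ ⟨c', x'⟩ h
    obtain ⟨γ, h1, h2⟩ := Quotient.exact (congrArg Subtype.val h)
    change c.out = c'.out * f γ at h1
    change x'.1 = γ • x.1 at h2
    have hc : c' = c := by
      rw [← Quotient.out_eq c, ← Quotient.out_eq c']
      change ((c'.out : Δ) : Δ ⧸ f.range) = (c.out : Δ)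
      rw [QuotientGroup.eq, h1, inv_mul_cancel_left]
      exact ⟨γ, rfl⟩
    subst hc
    have hγ : γ = 1 := hf (by rw [map_one]; exact left_eq_mul.1 h1)
    refine Prod.ext rfl (Subtype.ext ?_)
    simpa [hγ] using h2.symm
  · rintro ⟨⟨d, x⟩, h⟩
    obtain ⟨γ, hγ⟩ : (d : Δ ⧸ f.range).out⁻¹ * d ∈ f.range := by
      rw [← QuotientGroup.eq]
      exact Quotient.out_eq _
    refine ⟨((d : Δ ⧸ f.range), ⟨γ • x, fun δ hδ => ?_⟩), Subtype.ext (Quotient.sound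
      ⟨γ⁻¹, ?_, ?_⟩)⟩
    · obtain ⟨δ', h1, h2⟩ := (induce_smul_eq_iff f X (f δ) d x).1 (h _ hδ)
      have hc : δ * γ = γ * δ := hf (by rw [map_mul, map_mul, mul_comm'])
      rw [← mul_smul, hc, mul_smul, ← hf h1, h2]
    · change (d : Δ ⧸ f.range).out = d * f γ⁻¹
      rw [map_inv, hγ]
      simp
    · change x = γ⁻¹ • γ • x
      rw [inv_smul_smul]

/-- An `I`-fixed `φ` is determined by one value on each coset of `f(Γ)I`. By commutativity the
condition on that value is the same for every coset: being fixed by the preimage of `I`. -/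
theorem fixedCard_coinduce [Finite Δ] [IsMulCommutative Δ] (f : Γ →* Δ) (X : FinGSet Γ)
    (I : Subgroup Δ) :
    fixedCard I (coinduce f X) = fixedCard (I.comap f) X ^ (f.range ⊔ I).index := by
  have hd : ∀ d : Δ, ∃ γ : Γ, ∃ i ∈ I, d = f γ * (d : Δ ⧸ (f.range ⊔ I)).out * i := by
    intro d
    have h1 : (d : Δ ⧸ (f.range ⊔ I)).out⁻¹ * d ∈ f.range ⊔ I := by
      rw [← QuotientGroup.eq]
      exact Quotient.out_eq _
    obtain ⟨_, ⟨γ, rfl⟩, i, hi, h⟩ := Subgroup.mem_sup_of_normal_right.1 h1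
    refine ⟨γ, i, hi, ?_⟩
    rw [mul_comm' (f γ), mul_assoc, h, mul_inv_cancel_left]
  have hout : ∀ (d : Δ) (γ : Γ) (i : Δ), i ∈ I →
      ((f γ * d * i : Δ) : Δ ⧸ (f.range ⊔ I)) = (d : Δ ⧸ (f.range ⊔ I)) := by
    intro d γ i hi
    rw [eq_comm, QuotientGroup.eq, mul_comm' (f γ), mul_assoc, inv_mul_cancel_left]
    exact mul_mem (Subgroup.mem_sup_left ⟨γ, rfl⟩) (Subgroup.mem_sup_right hi)
  rw [fixedCard, fixedCard, Subgroup.index, ← Nat.card_fun]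
  refine Nat.card_congr (Equiv.ofBijective
    (fun φ c => ⟨φ.1.1 c.out, fun γ hγ => ?_⟩) ⟨?_, ?_⟩)
  · rw [← φ.1.2, mul_comm']
    exact congrFun (congrArg Subtype.val (φ.2 _ hγ)) c.out
  · intro φ ψ h
    refine Subtype.ext (Subtype.ext (funext fun d => ?_))
    obtain ⟨γ, i, hi, hdi⟩ := hd d
    have h1 : φ.1.1 (d : Δ ⧸ (f.range ⊔ I)).out = ψ.1.1 (d : Δ ⧸ (f.range ⊔ I)).out :=
      congrArg Subtype.val (congrFun h (d : Δ ⧸ (f.range ⊔ I)))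
    have h2 := congrFun (congrArg Subtype.val (φ.2 i hi)) (d : Δ ⧸ (f.range ⊔ I)).out
    have h3 := congrFun (congrArg Subtype.val (ψ.2 i hi)) (d : Δ ⧸ (f.range ⊔ I)).out
    change φ.1.1 (_ * i) = _ at h2
    change ψ.1.1 (_ * i) = _ at h3
    rw [hdi, mul_assoc, φ.1.2, ψ.1.2, h2, h3, h1]
  · intro x
    choose γ i hi hdi using hd
    -- Values at representatives are extended by `d = f γ * rep * i`. Two choices of `γ` differ by
    -- an element of the preimage of `I`, which fixes the value.
    have key : ∀ (d : Δ) (γ' : Γ) (i' : Δ), i' ∈ I →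
        d = f γ' * (d : Δ ⧸ (f.range ⊔ I)).out * i' →
          γ d • (x d).1 = γ' • (x d).1 := by
      intro d γ' i' hi' h
      have h1 : γ'⁻¹ * γ d ∈ I.comap f := by
        have h2 := (hdi d).symm.trans h
        have h3 : (f γ')⁻¹ * f (γ d) = i' * (i d)⁻¹ := by
          rw [inv_mul_eq_iff_eq_mul, ← mul_assoc, eq_mul_inv_iff_mul_eq]
          rw [mul_assoc, mul_comm' _ (i d), ← mul_assoc, mul_assoc _ _ i', mul_comm' _ i',
            ← mul_assoc] at h2
          exact mul_right_cancel h2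
        rw [Subgroup.mem_comap, map_mul, map_inv, h3]
        exact I.mul_mem hi' (I.inv_mem (hi d))
      have h3 := (x (d : Δ ⧸ (f.range ⊔ I))).2 _ h1
      rwa [mul_smul, inv_smul_eq_iff] at h3
    have hval : ∀ (d : Δ) (γ' : Γ) (i' : Δ), i' ∈ I →
        γ (f γ' * d * i') • (x ((f γ' * d * i' : Δ) : Δ ⧸ (f.range ⊔ I))).1 =
          γ' • γ d • (x (d : Δ ⧸ (f.range ⊔ I))).1 := by
      intro d γ' i' hi'
      rw [key (f γ' * d * i') (γ' * γ d) (i d * i') (I.mul_mem (hi d) hi')]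
      · rw [hout d γ' i' hi', mul_smul]
      · rw [hout d γ' i' hi']
        conv_lhs => rw [hdi d]
        simp [mul_assoc]
    refine ⟨⟨⟨fun d => γ d • (x (d : Δ ⧸ (f.range ⊔ I))).1, fun γ' d => ?_⟩, fun j hj => ?_⟩, ?_⟩
    · have := hval d γ' 1 I.one_mem
      rw [mul_one] at this
      exact this
    · refine Subtype.ext (funext fun d => ?_)
      have := hval d 1 j hj
      rw [show f 1 * d * j = d * j by simp, one_smul] at this
      exact this
    · funext c
      refine Subtype.ext ?_
      have hc : ((c.out : Δ) : Δ ⧸ (f.range ⊔ I)) = c := Quotient.out_eq c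
      have h1 := key c.out 1 1 I.one_mem (by rw [hc]; simp)
      rw [one_smul] at h1
      exact h1.trans (by rw [hc])

/-- A `p`-subgroup commuting with `I` does not change the number of `I`-fixed points modulo `p`. -/
theorem fixedCard_sup_modEq [IsMulCommutative Γ] (p : ℕ) [Fact p.Prime] (Q I : Subgroup Γ)
    (hQ : IsPGroup p Q) (X : FinGSet Γ) :
    fixedCard (Q ⊔ I) X ≡ fixedCard I X [MOD p] := by
  let act : MulAction Q {x : X.carrier // ∀ i ∈ I, i • x = x} :=
    { smul := fun g x => ⟨g.1 • x.1, fun i hi => by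
        rw [← mul_smul, mul_comm' i, mul_smul, x.2 i hi]⟩
      one_smul := fun x => Subtype.ext (one_smul Γ x.1)
      mul_smul := fun g h x => Subtype.ext (mul_smul g.1 h.1 x.1) }
  have h := hQ.card_modEq_card_fixedPoints {x : X.carrier // ∀ i ∈ I, i • x = x}
  refine Nat.ModEq.symm (h.trans ?_)
  have e : Nat.card (MulAction.fixedPoints Q {x : X.carrier // ∀ i ∈ I, i • x = x}) =
      fixedCard (Q ⊔ I) X := by
    refine Nat.card_congr ⟨fun x => ⟨x.1.1, fun g hg => ?_⟩,
      fun x => ⟨⟨x.1, fun i hi => x.2 i (Subgroup.mem_sup_right hi)⟩, fun g =>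
        Subtype.ext (x.2 g.1 (Subgroup.mem_sup_left g.2))⟩, fun _ => rfl, fun _ => rfl⟩
    have hle : Q ⊔ I ≤ MulAction.stabilizer Γ x.1.1 :=
      sup_le (fun g hg => congrArg Subtype.val (x.2 ⟨g, hg⟩)) x.1.2
    exact hle hg
  rw [e]

end FinGSet

/-! ### Marks of the structure maps of the Burnside ring -/

namespace BurnsideRing

variable {Γ Δ : Type u} [Group Γ] [Group Δ]

theorem exists_eq_of_sub_of (x : BurnsideRing Γ) : ∃ X Y : FinGSet Γ, x = of X - of Y := by
  obtain ⟨a, b, rfl⟩ := exists_eq_sub x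
  obtain ⟨X, rfl⟩ : ∃ X, a = BurnsideSemiring.mk X := ⟨a.out, (Quotient.out_eq a).symm⟩
  obtain ⟨Y, rfl⟩ : ∃ Y, b = BurnsideSemiring.mk Y := ⟨b.out, (Quotient.out_eq b).symm⟩
  exact ⟨X, Y, rfl⟩

theorem mark_pullback (f : Γ →* Δ) (I : Subgroup Γ) (x : BurnsideRing Δ) :
    mark I (pullback f x) = mark (I.map f) x := by
  obtain ⟨X, Y, rfl⟩ := exists_eq_of_sub_of x
  simp only [map_sub, pullback_of, mark_of, FinGSet.fixedCard_pullback]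

theorem mark_coset [Finite Γ] [IsMulCommutative Γ] (I K : Subgroup Γ) [Decidable (I ≤ K)] :
    mark I (of (FinGSet.coset K)) = if I ≤ K then (K.index : ℤ) else 0 := by
  rw [mark_of, FinGSet.fixedCard_coset]
  split_ifs <;> rfl

theorem mark_induce_of_not_le [Finite Δ] [IsMulCommutative Δ] (f : Γ →* Δ)
    (I : Subgroup Δ) (hI : ¬ I ≤ f.range) (x : BurnsideRing Γ) :
    mark I (induce f x) = 0 := by
  obtain ⟨X, Y, rfl⟩ := exists_eq_of_sub_of x
  simp [map_sub, induce_of, mark_of, FinGSet.fixedCard_induce_of_not_le f _ I hI]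

theorem mark_induce [Finite Δ] [IsMulCommutative Δ] (f : Γ →* Δ)
    (hf : Function.Injective f) (I : Subgroup Δ) (hI : I ≤ f.range) (x : BurnsideRing Γ) :
    mark I (induce f x) = f.range.index * mark (I.comap f) x := by
  obtain ⟨X, Y, rfl⟩ := exists_eq_of_sub_of x
  simp only [map_sub, induce_of, mark_of, FinGSet.fixedCard_induce f hf _ I hI]
  push_cast
  ring

/-- On actual sets this is the fixed point count. The exponent is at most `|Δ|`, so the
extrapolation defining the norm reproduces the power exactly on virtual sets. -/
theorem mark_coinduce [Finite Δ] [IsMulCommutative Δ] (f : Γ →* Δ) (I : Subgroup Δ)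
    (x : BurnsideRing Γ) :
    mark I (coinduce f x) = mark (I.comap f) x ^ (f.range ⊔ I).index := by
  obtain ⟨a, b, rfl⟩ := exists_eq_sub x
  have h : ∀ a, BurnsideSemiring.mark I (BurnsideSemiring.coinduce f a) =
      BurnsideSemiring.mark (I.comap f) a ^ (f.range ⊔ I).index := by
    rintro ⟨X⟩
    exact FinGSet.fixedCard_coinduce f X I
  rw [coinduce_sub, normPair, map_sum, map_sub, mark_ofSemiring, mark_ofSemiring]
  refine Eq.trans (Finset.sum_congr rfl fun k _ => ?_) ((extrapolate (Nat.card Δ)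
    (f.range ⊔ I).index (Nat.le_of_dvd Nat.card_pos (Subgroup.index_dvd_card _))
    (fun _ => (BurnsideSemiring.mark (I.comap f) a : ℤ))
    (fun _ => (BurnsideSemiring.mark (I.comap f) b : ℤ))).trans (by simp))
  rw [map_zsmul, mark_ofSemiring, h, smul_eq_mul]
  simp

/-- The exponent in `mark_coinduce` is an index, hence positive. So the summand `N(0)` in the norm
axiom for ideals disappears. -/
theorem coinduce_zero [Finite Δ] [IsMulCommutative Δ] (f : Γ →* Δ) :
    coinduce f (0 : BurnsideRing Γ) = 0 := by
  refine eq_of_mark_eq fun I => ?_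
  rw [mark_coinduce, map_zero, map_zero, zero_pow Subgroup.index_ne_zero_of_finite]

theorem mark_sup_modEq [IsMulCommutative Γ] (p : ℕ) [Fact p.Prime] (Q I : Subgroup Γ)
    (hQ : IsPGroup p Q) (x : BurnsideRing Γ) :
    mark (Q ⊔ I) x ≡ mark I x [ZMOD p] := by
  obtain ⟨X, Y, rfl⟩ := exists_eq_of_sub_of x
  simp only [map_sub, mark_of]
  exact (Int.natCast_modEq_iff.2 (FinGSet.fixedCard_sup_modEq p Q I hQ X)).sub
    (Int.natCast_modEq_iff.2 (FinGSet.fixedCard_sup_modEq p Q I hQ Y))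

/-! ### Elements with prescribed marks -/

/-- A multiple of the primitive idempotent of the ghost ring supported at `I`. -/
theorem exists_mark_eq_single [Finite Γ] [IsMulCommutative Γ] (I : Subgroup Γ) :
    ∃ e : BurnsideRing Γ, mark I e = (Nat.card Γ : ℤ) ^ Nat.card (Subgroup Γ) ∧
      ∀ J, J ≠ I → mark J e = 0 := by
  classical
  have : Fintype (Subgroup Γ) := Fintype.ofFinite _
  -- At `J < I` the factor `K = J` vanishes; at `J` not inside `I` the coset space of `I` has no
  -- fixed points. At `I` the mark is the product of the indices of `I` and of its proper subgroups.
  let e : BurnsideRing Γ := of (FinGSet.coset I) *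
    ∏ K ∈ Finset.univ.filter (· < I), ((K.index : BurnsideRing Γ) - of (FinGSet.coset K))
  have h0 : ∀ J, J ≠ I → mark J e = 0 := by
    intro J hJ
    simp only [e, map_mul, map_prod, map_sub, map_natCast, mark_coset]
    by_cases h : J ≤ I
    · refine mul_eq_zero_of_right _ (Finset.prod_eq_zero (i := J) ?_ (by simp))
      simpa using lt_of_le_of_ne h hJ
    · simp [h]
  have h1 : mark I e = (I.index : ℤ) * ∏ K ∈ Finset.univ.filter (· < I), (K.index : ℤ) := by
    simp only [e, map_mul, map_prod, map_sub, map_natCast, mark_coset, le_refl, if_true]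
    congr 1
    refine Finset.prod_congr rfl fun K hK => ?_
    simp [not_le_of_gt (Finset.mem_filter.1 hK).2]
  have h2 : mark I e ∣ (Nat.card Γ : ℤ) ^ Nat.card (Subgroup Γ) := by
    have hK : ∀ K : Subgroup Γ, (K.index : ℤ) ∣ Nat.card Γ := fun K =>
      Int.natCast_dvd_natCast.2 (Subgroup.index_dvd_card K)
    have h3 : I ∉ Finset.univ.filter (· < I) := by simp
    rw [h1, ← Finset.prod_insert (f := fun K : Subgroup Γ => (K.index : ℤ)) h3]
    refine (Finset.prod_dvd_prod_of_dvd _ (fun _ => (Nat.card Γ : ℤ)) fun K _ => hK K).trans ?_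
    rw [Finset.prod_const, Nat.card_eq_fintype_card (α := Subgroup Γ)]
    exact pow_dvd_pow _ (Finset.card_le_univ _)
  obtain ⟨c, hc⟩ := h2
  exact ⟨e * (c : BurnsideRing Γ), by rw [map_mul, map_intCast, hc, Int.cast_id], fun J hJ => by simp [h0 J hJ]⟩

/-- The cokernel of the Burnside ring in its ghost ring is killed by a power of the order. -/
theorem intCast_dvd_of_dvd_mark [Finite Γ] [IsMulCommutative Γ] (n : ℤ) (b : BurnsideRing Γ)
    (hb : ∀ I, (Nat.card Γ : ℤ) ^ Nat.card (Subgroup Γ) * n ∣ mark I b) :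
    (n : BurnsideRing Γ) ∣ b := by
  classical
  have : Fintype (Subgroup Γ) := Fintype.ofFinite _
  choose e he he' using exists_mark_eq_single (Γ := Γ)
  choose c hc using hb
  refine ⟨∑ I, (c I : BurnsideRing Γ) * e I, eq_of_mark_eq fun J => ?_⟩
  rw [map_mul, map_sum, Finset.sum_eq_single J]
  · simp only [map_mul, map_intCast, he, hc J, Int.cast_id]
    ring
  · intro I _ hI
    simp [he' I J hI.symm]
  · simp

/-- Multiplication by `k` supplies the rest of the exponent of the cokernel, and is cancelled
afterwards because `k` is coprime to `n`. -/
theorem intCast_dvd_of_dvd_mark_of_isCoprime [Finite Γ] [IsMulCommutative Γ] {n m k : ℤ}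
    (hD : (Nat.card Γ : ℤ) ^ Nat.card (Subgroup Γ) = k * m) (hn : IsCoprime n k)
    (b : BurnsideRing Γ) (hb : ∀ I, m * n ∣ mark I b) : (n : BurnsideRing Γ) ∣ b := by
  have h : (n : BurnsideRing Γ) ∣ (k : BurnsideRing Γ) * b := by
    refine intCast_dvd_of_dvd_mark n _ fun I => ?_
    rw [map_mul, map_intCast, hD, mul_assoc]
    exact mul_dvd_mul_left k (hb I)
  exact IsCoprime.dvd_of_dvd_mul_left (hn.map (Int.castRingHom (BurnsideRing Γ))) h

/-- An ideal containing `y` contains an element with constant marks on the support of `y`, and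
zero marks elsewhere. -/
theorem exists_mem_mark_eq [Finite Γ] (𝔞 : Ideal (BurnsideRing Γ)) {y : BurnsideRing Γ}
    (hy : y ∈ 𝔞) (M : Submonoid ℤ) (hM : ∀ I, mark I y ≠ 0 → mark I y ∈ M) :
    ∃ f ∈ 𝔞, ∃ m ∈ M, ∀ I, (mark I y ≠ 0 → mark I f = m) ∧ (mark I y = 0 → mark I f = 0) := by
  classical
  have : Fintype (Subgroup Γ) := Fintype.ofFinite _
  let S : Finset (Subgroup Γ) := Finset.univ.filter fun I => mark I y ≠ 0
  -- Modulo `𝔞` the two products agree, as `y` is zero there. At `I` in the support the second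
  -- product has a zero factor; outside it the two have the same mark.
  refine ⟨((∏ I ∈ S, mark I y : ℤ) : BurnsideRing Γ) -
    ∏ I ∈ S, ((mark I y : BurnsideRing Γ) - y), ?_, ∏ I ∈ S, mark I y,
    prod_mem fun I hI => hM I (Finset.mem_filter.1 hI).2, fun I => ⟨fun hI => ?_, fun hI => ?_⟩⟩
  · rw [← Ideal.Quotient.eq_zero_iff_mem, map_sub, map_prod]
    simp [Ideal.Quotient.eq_zero_iff_mem.2 hy]
  · have h : ∏ J ∈ S, (mark J y - mark I y) = 0 :=
      Finset.prod_eq_zero (i := I) (by simpa [S] using hI) (sub_self _)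
    simp [h]
  · simp [hI]

end BurnsideRing

/-! ### Ideals defined by divisibility of marks -/

namespace TambaraIdeal

variable {G : Type u} [Group G]

theorem map_subtype_comap_inclusion_le {K H : Subgroup G} (h : K ≤ H) (I : Subgroup H) :
    (I.comap (Subgroup.inclusion h)).map K.subtype ≤ I.map H.subtype := by
  rintro _ ⟨x, hx, rfl⟩
  exact ⟨Subgroup.inclusion h x, hx, rfl⟩

theorem map_subtype_map_inclusion {K H : Subgroup G} (h : K ≤ H) (I : Subgroup K) :
    (I.map (Subgroup.inclusion h)).map H.subtype = I.map K.subtype := by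
  rw [Subgroup.map_map]
  rfl

theorem mulLevel_subset [Finite G] {I J P : TambaraIdeal G}
    (h : ∀ H, ∀ a ∈ I.level H, ∀ b ∈ J.level H, a * b ∈ P.level H) (H : Subgroup G) :
    mulLevel I J H ⊆ P.level H := by
  rintro _ ⟨n, K, hK, a, b, ha, hb, rfl⟩
  exact sum_mem fun i _ => P.tr_mem (hK i) _ (h _ _ (ha i) _ (hb i))

theorem mem_burnsidePrime [IsCyclic G] {C : Subgroup G} {q : ℕ} {H : Subgroup G}
    {x : BurnsideRing H} :
    x ∈ burnsidePrime C q H ↔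
      ∀ I : Subgroup H, I.map H.subtype ≤ C → (q : ℤ) ∣ BurnsideRing.mark I x := by
  simp only [burnsidePrime, Ideal.mem_iInf, Subtype.forall, IsCyclic.conjSubgroup_eq,
    exists_const, RingHom.mem_ker, RingHom.comp_apply, eq_intCast,
    ZMod.intCast_zmod_eq_zero_iff_dvd]

variable [IsCyclic G]

theorem map_subtype_map_conjHom (H : Subgroup G) (g : G) (I : Subgroup (conjSubgroup H g)) :
    (I.map (conjHom H g)).map H.subtype = I.map (conjSubgroup H g).subtype := by
  rw [Subgroup.map_map]
  congr 1
  ext x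
  change g * x.1 * g⁻¹ = x.1
  rw [mul_comm' g, mul_inv_cancel_right]

variable [Finite G]

/-- The ideal of all elements whose marks at the subgroups of `C` are divisible by `a`. -/
def markIdeal (C : Subgroup G) (a : ℤ) : TambaraIdeal G where
  level H :=
    { carrier := {x | ∀ I : Subgroup H, I.map H.subtype ≤ C → a ∣ BurnsideRing.mark I x}
      zero_mem' := fun I _ => by simp
      add_mem' := fun hx hy I hI => by rw [map_add]; exact dvd_add (hx I hI) (hy I hI)
      smul_mem' := fun c x hx I hI => by
        rw [smul_eq_mul, map_mul]; exact Dvd.dvd.mul_left (hx I hI) _ }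
  res_mem h x hx I hI := by
    rw [BurnsideTambara.res, BurnsideRing.mark_pullback]
    exact hx _ (by rwa [map_subtype_map_inclusion])
  tr_mem h x hx I hI := by
    rw [BurnsideTambara.tr]
    by_cases hr : I ≤ (Subgroup.inclusion h).range
    · rw [BurnsideRing.mark_induce _ (Subgroup.inclusion_injective h) I hr]
      exact Dvd.dvd.mul_left (hx _ ((map_subtype_comap_inclusion_le h I).trans hI)) _
    · rw [BurnsideRing.mark_induce_of_not_le _ I hr]
      exact dvd_zero _
  norm_mem h x hx := by
    refine ⟨BurnsideTambara.norm h x, fun I hI => ?_,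
      (add_eq_left.2 (BurnsideRing.coinduce_zero _)).symm⟩
    rw [BurnsideTambara.norm, BurnsideRing.mark_coinduce]
    exact dvd_pow (hx _ ((map_subtype_comap_inclusion_le h I).trans hI))
      Subgroup.index_ne_zero_of_finite
  conj_mem g H x hx I hI := by
    rw [BurnsideTambara.conj, BurnsideRing.mark_pullback]
    exact hx _ (by rwa [map_subtype_map_conjHom])

theorem burnsidePrime_eq (C : Subgroup G) (q : ℕ) (H : Subgroup G) :
    burnsidePrime C q H = (markIdeal C q).level H := by
  ext x
  exact mem_burnsidePrime

/-- Marks are multiplicative, so the ideals for `a ^ (k + 1)` and `a` multiply into the one for `a ^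
(k + 2)`; primality lowers the exponent one step at a time. -/
theorem markIdeal_le_of_pow {P : TambaraIdeal G} (hP : P.IsPrime) {C : Subgroup G} {a : ℤ}
    {k : ℕ} (hk : ∀ H, (markIdeal C (a ^ (k + 1))).level H ≤ P.level H) :
    ∀ H, (markIdeal C a).level H ≤ P.level H := by
  induction k with
  | zero => simpa using hk
  | succ k ih =>
    refine (hP.2 (markIdeal C (a ^ (k + 1))) (markIdeal C a) fun H =>
      mulLevel_subset (fun H x hx y hy => hk H fun I hI => ?_) H).elim ih id
    rw [map_mul, pow_succ _ (k + 1)]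
    exact mul_dvd_mul (hx I hI) (hy I hI)

/-- A prime `q` divides a mark at `I` as soon as it divides the mark at the part of `I` of order
prime to `q`. -/
theorem markIdeal_le_of_factorization {q : ℕ} (hq : q.Prime) {C C' : Subgroup G}
    (h : ∀ p, p ≠ q → (Nat.card C').factorization p ≤ (Nat.card C).factorization p)
    (H : Subgroup G) : (markIdeal C q).level H ≤ (markIdeal C' q).level H := by
  intro x hx I hI
  have := Fact.mk hq
  -- `I` is split into its `q`-part `Q` and its prime-to-`q` part `J`. Only primes other than `q`
  -- matter for `J ≤ C`, and the marks at `I = Q ⊔ J` and `J` agree modulo `q`.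
  set n := Nat.card I with hn
  have hn0 : n ≠ 0 := Nat.card_pos.ne'
  have hnH : n ∣ Nat.card H := Subgroup.card_subgroup_dvd_card I
  obtain ⟨Q, hQ⟩ := IsCyclic.exists_subgroup_card_eq ((Nat.ordProj_dvd n q).trans hnH)
  obtain ⟨J, hJ⟩ := IsCyclic.exists_subgroup_card_eq ((Nat.ordCompl_dvd n q).trans hnH)
  have hQJ : Q ⊔ J = I := by
    refine le_antisymm (sup_le (IsCyclic.subgroup_le_of_card_dvd ?_)
      (IsCyclic.subgroup_le_of_card_dvd ?_)) (IsCyclic.subgroup_le_of_card_dvd ?_)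
    · rw [hQ]; exact Nat.ordProj_dvd n q
    · rw [hJ]; exact Nat.ordCompl_dvd n q
    · rw [← hn, ← Nat.ordProj_mul_ordCompl_eq_self n q]
      refine Nat.Coprime.mul_dvd_of_dvd_of_dvd ?_ ?_ ?_
      · exact (Nat.coprime_ordCompl hq hn0).pow_left _
      · rw [← hQ]; exact Subgroup.card_dvd_of_le le_sup_left
      · rw [← hJ]; exact Subgroup.card_dvd_of_le le_sup_right
  have hJC : J.map H.subtype ≤ C := by
    refine IsCyclic.subgroup_le_of_card_dvd ?_
    rw [Subgroup.card_map_of_injective H.subtype_injective, hJ,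
      ← Nat.factorization_le_iff_dvd (Nat.ordCompl_pos q hn0).ne' Nat.card_pos.ne',
      Nat.factorization_ordCompl]
    intro p
    by_cases hp : p = q
    · simp [hp]
    · rw [Finsupp.erase_ne hp]
      refine le_trans ?_ (h p hp)
      refine (Nat.factorization_le_iff_dvd hn0 Nat.card_pos.ne').2 ?_ p
      have := Subgroup.card_dvd_of_le hI
      rwa [Subgroup.card_map_of_injective H.subtype_injective] at this
  have hmod := BurnsideRing.mark_sup_modEq q Q J (IsPGroup.of_card hQ) x
  rw [hQJ] at hmod
  exact (Int.ModEq.dvd_iff hmod).2 (hx J hJC)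

end TambaraIdeal

/-! ### Elements of `P` obtained as norms -/

namespace TambaraIdeal

variable {G : Type u} [Group G] [Finite G] [IsCyclic G]

theorem norm_mem_level (P : TambaraIdeal G) {K H : Subgroup G} (h : K ≤ H) {x : BurnsideRing K}
    (hx : x ∈ P.level K) : BurnsideTambara.norm h x ∈ P.level H := by
  obtain ⟨y, hy, hxy⟩ := P.norm_mem h x hx
  have h0 : BurnsideTambara.norm h 0 = 0 := BurnsideRing.coinduce_zero _
  rwa [hxy, h0, add_zero]

/-- A positive power of `q` lies in each level of an ideal over `q`. -/
theorem exists_pow_mem_level {P : TambaraIdeal G} {q : ℕ} (hP : P.IsOver q) (H : Subgroup G) :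
    ∃ j : ℕ, (((q : ℤ) ^ j : ℤ) : BurnsideRing H) ∈ P.level H := by
  -- For `q = 0` the exponent must be positive, since `0 ^ 0 = 1`.
  rcases eq_or_ne q 0 with rfl | hq
  · exact ⟨1, by simp⟩
  have hmem : (q : BurnsideRing (⊥ : Subgroup G)) ∈ P.level ⊥ := by
    rw [hP]; exact Ideal.mem_span_singleton_self _
  have hmark : ∀ I, BurnsideRing.mark I (BurnsideTambara.norm (bot_le : ⊥ ≤ H) (q : BurnsideRing _)) =
      (q : ℤ) ^ ((Subgroup.inclusion (bot_le : ⊥ ≤ H)).range ⊔ I).index := fun I => by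
    rw [BurnsideTambara.norm, BurnsideRing.mark_coinduce, map_natCast]
  -- The norm of `q` has a power of `q` as each mark, with exponent depending on `I`. Once the marks
  -- are made equal, the element is an integer.
  obtain ⟨f, hf, m, ⟨j, rfl⟩, hm⟩ := BurnsideRing.exists_mem_mark_eq (P.level H)
    (P.norm_mem_level bot_le hmem) (Submonoid.powers (q : ℤ)) fun I _ => ⟨_, (hmark I).symm⟩
  refine ⟨j, ?_⟩
  convert hf using 1
  refine BurnsideRing.eq_of_mark_eq fun I => ?_
  rw [(hm I).1 (by rw [hmark]; exact pow_ne_zero _ (by exact_mod_cast hq)), map_intCast,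
    Int.cast_id]

/-- The mark at `I` is a power of the mark of `t_p - p` at `I ∩ S`, which is `-p` if `I ∩ S = S` and
zero otherwise, as every proper subgroup of `S` lies in `K`. Containing `S` means having order
divisible by `p ^ (n + 1)`. -/
theorem mark_norm_coset_sub {p n : ℕ} (hp : p.Prime) {S H : Subgroup G} (h : S ≤ H)
    (hS : Nat.card S = p ^ (n + 1)) (K : Subgroup S) (hK : K.index = p) (I : Subgroup H) :
    BurnsideRing.mark I (BurnsideTambara.norm h
      (BurnsideRing.of (FinGSet.coset K) - (p : BurnsideRing S))) =
        if p ^ (n + 1) ∣ Nat.card I then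
          (-p : ℤ) ^ ((Subgroup.inclusion h).range ⊔ I).index else 0 := by
  classical
  have hKc : Nat.card K = p ^ n := by
    have := K.index_mul_card
    rw [hK, hS, pow_succ'] at this
    exact Nat.eq_of_mul_eq_mul_left hp.pos this
  rw [BurnsideTambara.norm, BurnsideRing.mark_coinduce, map_sub, map_natCast,
    BurnsideRing.mark_coset, hK]
  have hinj := Subgroup.inclusion_injective h
  split_ifs with h1 h2 h2
  · exfalso
    have hr : Nat.card (Subgroup.inclusion h).range = p ^ (n + 1) := by
      rw [← hS]
      exact Nat.card_congr (MonoidHom.ofInjective hinj).toEquiv.symm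
    have h3 : (Subgroup.inclusion h).range ≤ I :=
      IsCyclic.subgroup_le_of_card_dvd (by rwa [hr])
    have h4 : (⊤ : Subgroup S) ≤ K := fun x _ => h1 (h3 ⟨x, rfl⟩)
    rw [top_le_iff.1 h4, Subgroup.index_top] at hK
    exact hp.one_lt.ne hK
  · simp [zero_pow Subgroup.index_ne_zero_of_finite]
  · simp
  · exfalso
    obtain ⟨i, hi, hIi⟩ := (Nat.dvd_prime_pow hp).1
      (hS ▸ Subgroup.card_subgroup_dvd_card (I.comap (Subgroup.inclusion h)))
    rcases hi.lt_or_eq with hi | rfl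
    · refine h1 (IsCyclic.subgroup_le_of_card_dvd ?_)
      rw [hIi, hKc]
      exact pow_dvd_pow _ (Nat.lt_succ_iff.1 hi)
    · refine h2 ?_
      rw [← hIi, ← Subgroup.card_map_of_injective hinj]
      exact Subgroup.card_dvd_of_le (Subgroup.map_comap_le _ _)

theorem isPrime_span_natCast {q : ℕ} (hq : q.Prime ∨ q = 0) :
    (Ideal.span {(q : ℤ)}).IsPrime := by
  rcases hq with hq | rfl
  · exact (Ideal.span_singleton_prime (by exact_mod_cast hq.ne_zero)).2
      (Nat.prime_iff_prime_int.1 hq)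
  · simpa using Ideal.isPrime_bot

variable {P : TambaraIdeal G} {q : ℕ} [(Ideal.span {(q : ℤ)}).IsPrime]

theorem exists_mem_level_mark_eq {p n : ℕ} (hp : p.Prime)
    (hpq : (p : ℤ) ∉ Ideal.span {(q : ℤ)})
    (hP : ∀ S : Subgroup G, Nat.card S = p ^ (n + 1) → ∀ K : Subgroup S, K.index = p →
      BurnsideRing.of (FinGSet.coset K) - (p : BurnsideRing S) ∈ P.level S) (H : Subgroup G) :
    ∃ f ∈ P.level H, ∃ m ∈ (Ideal.span {(q : ℤ)}).primeCompl, ∀ I : Subgroup H,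
      p ^ (n + 1) ∣ Nat.card I → BurnsideRing.mark I f = m := by
  by_cases hH : p ^ (n + 1) ∣ Nat.card H
  · obtain ⟨S, hS⟩ := IsCyclic.exists_subgroup_card_eq
      (hH.trans (Subgroup.card_subgroup_dvd_card H))
    have hSH : S ≤ H := IsCyclic.subgroup_le_of_card_dvd (by rwa [hS])
    obtain ⟨K, hK⟩ : ∃ K : Subgroup S, Nat.card K = p ^ n :=
      IsCyclic.exists_subgroup_card_eq (by rw [hS]; exact pow_dvd_pow _ n.le_succ)
    have hKi : K.index = p := by
      have := K.index_mul_card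
      rw [hS, hK, pow_succ'] at this
      exact Nat.eq_of_mul_eq_mul_right (pow_pos hp.pos n) this
    have hmark := mark_norm_coset_sub hp hSH hS K hKi
    have hne : ∀ k : ℕ, (-p : ℤ) ^ k ≠ 0 := fun k =>
      pow_ne_zero k (neg_ne_zero.2 (by exact_mod_cast hp.ne_zero))
    obtain ⟨f, hf, m, hm, hfm⟩ := BurnsideRing.exists_mem_mark_eq (P.level H)
      (P.norm_mem_level hSH (hP S hS K hKi)) (Ideal.span {(q : ℤ)}).primeCompl fun I hI => by
        rw [hmark] at hI ⊢
        rw [ite_ne_right_iff] at hI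
        rw [if_pos hI.1]
        have hp' : (-p : ℤ) ∈ (Ideal.span {(q : ℤ)}).primeCompl := fun h =>
          hpq (neg_mem_iff.1 h)
        exact pow_mem hp' _
    refine ⟨f, hf, m, hm, fun I hI => (hfm I).1 ?_⟩
    rw [hmark, if_pos hI]
    exact hne _
  -- No subgroup of `H` has order divisible by `p ^ (n + 1)` here, so the condition on marks is
  -- empty.
  · exact ⟨0, zero_mem _, 1, one_mem _, fun I hI =>
      (hH (hI.trans (Subgroup.card_subgroup_dvd_card I))).elim⟩

/-- Modulo `P`, an element supported on the subgroups of `C` is a number prime to `q`. -/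
theorem exists_sub_mem_level {C : Subgroup G}
    (hC : (Nat.card G).factorization q ≤ (Nat.card C).factorization q)
    (hP : ∀ p : ℕ, p.Prime → p ≠ q → ∀ S : Subgroup G,
      Nat.card S = p ^ ((Nat.card C).factorization p + 1) → ∀ K : Subgroup S, K.index = p →
        BurnsideRing.of (FinGSet.coset K) - (p : BurnsideRing S) ∈ P.level S) (H : Subgroup G)
    (hpq : ∀ p : ℕ, p.Prime → p ≠ q → (p : ℤ) ∉ Ideal.span {(q : ℤ)}) :
    ∃ E : BurnsideRing H, ∃ m ∈ (Ideal.span {(q : ℤ)}).primeCompl,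
      (m : BurnsideRing H) - E ∈ P.level H ∧
        ∀ I : Subgroup H, ¬ I.map H.subtype ≤ C → BurnsideRing.mark I E = 0 := by
  have key : ∀ p : ℕ, p ∈ (Nat.card G).primeFactors.erase q →
      ∃ f ∈ P.level H, ∃ m ∈ (Ideal.span {(q : ℤ)}).primeCompl, ∀ I : Subgroup H,
        p ^ ((Nat.card C).factorization p + 1) ∣ Nat.card I → BurnsideRing.mark I f = m := by
    intro p hp
    rw [Finset.mem_erase] at hp
    have hpp := Nat.prime_of_mem_primeFactors hp.2
    exact exists_mem_level_mark_eq hpp (hpq p hpp hp.1) (hP p hpp hp.1) H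
  choose! f hf m hm hfm using key
  -- Modulo `P` each factor is `m p`. The factor at `p` has mark zero at every `I` whose `p`-part
  -- exceeds that of `C`.
  refine ⟨∏ p ∈ (Nat.card G).primeFactors.erase q, ((m p : BurnsideRing H) - f p),
    ∏ p ∈ (Nat.card G).primeFactors.erase q, m p, prod_mem hm, ?_, fun I hI => ?_⟩
  · rw [← Ideal.Quotient.eq_zero_iff_mem, map_sub, map_prod, map_intCast, Int.cast_prod,
      sub_eq_zero]
    refine Finset.prod_congr rfl fun p hp => ?_
    rw [map_sub, Ideal.Quotient.eq_zero_iff_mem.2 (hf p hp), sub_zero, map_intCast]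
  · have hI' : ¬ Nat.card I ∣ Nat.card C := fun h => hI (IsCyclic.subgroup_le_of_card_dvd (by
      rwa [Subgroup.card_map_of_injective H.subtype_injective]))
    rw [← Nat.factorization_le_iff_dvd Nat.card_pos.ne' Nat.card_pos.ne', Finsupp.le_def] at hI'
    push Not at hI'
    obtain ⟨p, hp⟩ := hI'
    have hpI : p ∈ (Nat.card I).primeFactors := by
      rw [← Nat.support_factorization, Finsupp.mem_support_iff]
      omega
    have hIG : Nat.card I ∣ Nat.card G :=
      (Subgroup.card_subgroup_dvd_card I).trans (Subgroup.card_subgroup_dvd_card H)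
    have hpT : p ∈ (Nat.card G).primeFactors.erase q := by
      refine Finset.mem_erase.2 ⟨?_, Nat.primeFactors_mono hIG Nat.card_pos.ne' hpI⟩
      -- The offending prime is not `q`, because `C` contains the full `q`-part of `G`.
      rintro rfl
      have := (Nat.factorization_le_iff_dvd Nat.card_pos.ne' Nat.card_pos.ne').2 hIG p
      omega
    rw [map_prod]
    refine Finset.prod_eq_zero hpT ?_
    rw [map_sub, map_intCast, hfm p hpT I, Int.cast_id, sub_self]
    exact (pow_dvd_pow p hp).trans (Nat.ordProj_dvd _ _)

/-! ### Clearing denominators and applying primality -/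

theorem exists_eq_pow_mul (hq : q.Prime ∨ q = 0) {D : ℕ} (hD : D ≠ 0) :
    ∃ h : ℕ, ∃ m ∈ (Ideal.span {(q : ℤ)}).primeCompl, (D : ℤ) = (q : ℤ) ^ h * m ∧
      ∀ n ∈ (Ideal.span {(q : ℤ)}).primeCompl, IsCoprime n ((q : ℤ) ^ h) := by
  rcases hq with hq | rfl
  · obtain ⟨h, m, hm, hDm⟩ := Nat.exists_eq_pow_mul_and_not_dvd hD q hq.ne_one
    refine ⟨h, m, fun hm' => hm ?_, by rw [hDm]; push_cast; rfl, fun n hn => ?_⟩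
    · exact Int.natCast_dvd_natCast.1 (Ideal.mem_span_singleton.1 hm')
    · exact (((Nat.prime_iff_prime_int.1 hq).coprime_iff_not_dvd).2
        fun h => hn (Ideal.mem_span_singleton.2 h)).symm.pow_right
  · refine ⟨0, D, ?_, by simp, fun n _ => by simpa using isCoprime_one_right⟩
    simpa [Ideal.primeCompl] using hD

/-- `m * x` is `E * x` modulo `P`, and `E * x` has all marks highly divisible by `q`. The integer
multiplier is replaced by elements `b` with divisible marks, because `markIdeal ⊤ μ` is an ideal of
the Tambara functor, to which primality applies. -/
theorem exists_mul_mem_level (hq : q.Prime ∨ q = 0) (hPq : P.IsOver q) {C : Subgroup G}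
    {H : Subgroup G}
    (hE : ∃ E : BurnsideRing H, ∃ m ∈ (Ideal.span {(q : ℤ)}).primeCompl,
      (m : BurnsideRing H) - E ∈ P.level H ∧
        ∀ I : Subgroup H, ¬ I.map H.subtype ≤ C → BurnsideRing.mark I E = 0) :
    ∃ k : ℕ, ∃ μ ∈ (Ideal.span {(q : ℤ)}).primeCompl,
      ∀ x ∈ (markIdeal C ((q : ℤ) ^ k)).level H, ∀ b ∈ (markIdeal ⊤ μ).level H,
        x * b ∈ P.level H := by
  obtain ⟨E, m, hm, hmE, hE⟩ := hE
  obtain ⟨j, hj⟩ := exists_pow_mem_level hPq H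
  obtain ⟨h, m', hm', hD, hcop⟩ := exists_eq_pow_mul hq
    (D := Nat.card H ^ Nat.card (Subgroup H)) (pow_ne_zero _ Nat.card_pos.ne')
  rw [Nat.cast_pow] at hD
  -- `q ^ h` and `m'` are the parts of the cokernel exponent at `q` and away from `q`. `q ^ j` lies
  -- in `P`, and the outer `m'` in `μ` is spent on dividing `b` by `m * m'`.
  refine ⟨h + j, m' * (m * m'), mul_mem hm' (mul_mem hm hm'), fun x hx b hb => ?_⟩
  have hEx : (m' : BurnsideRing H) * (E * x) ∈ P.level H := by
    refine Ideal.mem_of_dvd _ (BurnsideRing.intCast_dvd_of_dvd_mark ((q : ℤ) ^ j) _ fun I => ?_) hj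
    simp only [map_mul, map_intCast, Int.cast_id, hD]
    by_cases hI : I.map H.subtype ≤ C
    · obtain ⟨c, hc⟩ := hx I hI
      rw [hc]
      exact ⟨BurnsideRing.mark I E * c, by ring⟩
    · simp [hE I hI]
  obtain ⟨c, rfl⟩ := BurnsideRing.intCast_dvd_of_dvd_mark_of_isCoprime hD
    (hcop _ (mul_mem hm hm')) b fun I => hb I le_top
  have h1 : x * (((m * m' : ℤ) : BurnsideRing H) * c) =
      (m' * x * c) * ((m : BurnsideRing H) - E) + c * (m' * (E * x)) := by
    push_cast
    ring
  rw [h1]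
  exact add_mem (Ideal.mul_mem_left _ _ hmE) (Ideal.mul_mem_left _ _ hEx)

theorem markIdeal_le_of_coset_sub_mem (hq : q.Prime ∨ q = 0) (hprime : P.IsPrime)
    (hPq : P.IsOver q) {C : Subgroup G}
    (hC : (Nat.card G).factorization q ≤ (Nat.card C).factorization q)
    (hP : ∀ p : ℕ, p.Prime → p ≠ q → ∀ S : Subgroup G,
      Nat.card S = p ^ ((Nat.card C).factorization p + 1) → ∀ K : Subgroup S, K.index = p →
        BurnsideRing.of (FinGSet.coset K) - (p : BurnsideRing S) ∈ P.level S) (H : Subgroup G) :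
    (markIdeal C q).level H ≤ P.level H := by
  classical
  have : Fintype (Subgroup G) := Fintype.ofFinite _
  have hpq : ∀ p : ℕ, p.Prime → p ≠ q → (p : ℤ) ∉ Ideal.span {(q : ℤ)} := by
    intro p hp hne h
    rw [Ideal.mem_span_singleton, Int.natCast_dvd_natCast] at h
    rcases hq with hq | rfl
    · exact hne ((Nat.prime_dvd_prime_iff_eq hq hp).1 h).symm
    · exact hp.ne_zero (zero_dvd_iff.1 h)
  choose k μ hμ hk using fun H => exists_mul_mem_level hq hPq (exists_sub_mem_level hC hP H hpq)
  -- The sum of the `k H` and the product of the `μ H` serve all levels at once.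
  refine markIdeal_le_of_pow hprime (k := ∑ H, k H) ?_ H
  refine (hprime.2 _ (markIdeal ⊤ (∏ H, μ H)) (mulLevel_subset fun H x hx b hb => hk H x
    (fun I hI => ?_) b fun I hI => ?_)).resolve_right fun h => ?_
  · refine (pow_dvd_pow _ ?_).trans (hx I hI)
    exact (Finset.single_le_sum (f := k) (fun _ _ => Nat.zero_le _) (Finset.mem_univ H)).trans
      (Nat.le_succ _)
  · exact (Finset.dvd_prod_of_mem μ (Finset.mem_univ H)).trans (hb I hI)
  -- Otherwise the integer `∏ μ H` would lie in `P` at `G/e`, that is in `(q)`, although each factor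
  -- is outside this prime ideal.
  · have h1 : ((∏ H, μ H : ℤ) : BurnsideRing (⊥ : Subgroup G)) ∈ P.level ⊥ :=
      h ⊥ fun I _ => by rw [map_intCast, Int.cast_id]
    rw [hPq, Ideal.mem_span_singleton] at h1
    have h2 := map_dvd (BurnsideRing.mark ⊥) h1
    rw [map_intCast, map_natCast, Int.cast_id] at h2
    exact (prod_mem fun H _ => hμ H : (∏ H, μ H) ∈ (Ideal.span {(q : ℤ)}).primeCompl)
      (Ideal.mem_span_singleton.2 h2)

end TambaraIdeal

/-! ### Reduction to Sylow subgroups and conclusion -/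

theorem card_sylowIn {G : Type u} [Group G] [Finite G] (p : ℕ) [Fact p.Prime] (C : Subgroup G) :
    Nat.card (sylowIn p C) = p ^ (Nat.card C).factorization p := by
  rw [sylowIn, Subgroup.card_map_of_injective C.subtype_injective]
  exact Sylow.card_eq_multiplicity _

namespace TambaraIdeal

variable {G : Type u} [Group G] [Finite G] [IsCyclic G]

/-- For prime `q`, `C` is enlarged to `C'` by the Sylow `q`-subgroup of `G`. This does not change
the ideal modulo `q`, nor the conditions at primes other than `q`. -/
theorem burnsidePrime_le_of_coset_sub_mem {P : TambaraIdeal G} {q : ℕ} (hq : q.Prime ∨ q = 0)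
    (hprime : P.IsPrime) (hPq : P.IsOver q) {C : Subgroup G}
    (hP : ∀ p : ℕ, p.Prime → ∀ S : Subgroup G,
      Nat.card S = p ^ ((Nat.card C).factorization p + 1) → ∀ K : Subgroup S, K.index = p →
        BurnsideRing.of (FinGSet.coset K) - (p : BurnsideRing S) ∈ P.level S) (H : Subgroup G) :
    burnsidePrime C q H ≤ P.level H := by
  have := isPrime_span_natCast hq
  rw [burnsidePrime_eq]
  rcases hq with hq' | rfl
  · have hn0 : Nat.card G ≠ 0 := Nat.card_pos.ne'
    have hq0 : q ^ (Nat.card G).factorization q ≠ 0 := pow_ne_zero _ hq'.ne_zero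
    obtain ⟨C', hC'⟩ : ∃ C' : Subgroup G,
        Nat.card C' = (Nat.card C).lcm (q ^ (Nat.card G).factorization q) :=
      IsCyclic.exists_subgroup_card_eq
        (Nat.lcm_dvd (Subgroup.card_subgroup_dvd_card C) (Nat.ordProj_dvd _ _))
    have hfac : ∀ p, p ≠ q →
        (Nat.card C').factorization p = (Nat.card C).factorization p := fun p hp => by
      rw [hC', Nat.factorization_lcm Nat.card_pos.ne' hq0, Finsupp.sup_apply,
        hq'.factorization_pow, Finsupp.single_apply, if_neg hp.symm]
      simp
    refine (markIdeal_le_of_factorization hq' (fun p hp => (hfac p hp).le) H).trans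
      (markIdeal_le_of_coset_sub_mem (.inl hq') hprime hPq ?_ (fun p hp hpq S hS => ?_) H)
    · rw [hC', Nat.factorization_lcm Nat.card_pos.ne' hq0, Finsupp.sup_apply,
        hq'.factorization_pow, Finsupp.single_eq_same]
      exact le_sup_right
    · exact hP p hp S (by rw [hS, hfac p hpq])
  · exact markIdeal_le_of_coset_sub_mem (.inr rfl) hprime hPq (by simp) (fun p hp _ => hP p hp) H

/-- `K` has the order of `Syl_p(C)`, so it contains every subgroup of `S` tested by the family of
`Syl_p(C)`; at these `t_p` has mark `p`, and `t_p - p` has mark zero. -/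
theorem coset_sub_mem_of_restrict_eq {P : TambaraIdeal G} {q p : ℕ} (hp : p.Prime)
    {C : Subgroup G}
    (hP : P.restrict (sylowIn p (⊤ : Subgroup G)) =
      burnsidePrime ((sylowIn p C).subgroupOf (sylowIn p (⊤ : Subgroup G))) q)
    (S : Subgroup G) (hS : Nat.card S = p * Nat.card (sylowIn p C)) (K : Subgroup S)
    (hK : K.index = p) :
    BurnsideRing.of (FinGSet.coset K) - (p : BurnsideRing S) ∈ P.level S := by
  classical
  have := Fact.mk hp
  have hle : S ≤ sylowIn p ⊤ := by
    refine IsCyclic.subgroup_le_of_card_dvd ?_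
    have h := Subgroup.card_subgroup_dvd_card S
    rw [hS, card_sylowIn, ← pow_succ'] at h ⊢
    rw [card_sylowIn, Subgroup.card_top]
    exact pow_dvd_pow _ ((hp.pow_dvd_iff_le_factorization Nat.card_pos.ne').1 h)
  obtain ⟨T, rfl⟩ : ∃ T : Subgroup (sylowIn p (⊤ : Subgroup G)), S = T.map (Subgroup.subtype _) :=
    ⟨S.subgroupOf _, (Subgroup.map_subgroupOf_eq_of_le hle).symm⟩
  let e := T.equivMapOfInjective _ (sylowIn p (⊤ : Subgroup G)).subtype_injective
  let x : BurnsideRing T := BurnsideRing.pullback e.toMonoidHom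
    (BurnsideRing.of (FinGSet.coset K) - (p : BurnsideRing _))
  have hx : x ∈ P.restrict (sylowIn p (⊤ : Subgroup G)) T := by
    rw [hP, mem_burnsidePrime]
    intro I hI
    have hIK : I.map e.toMonoidHom ≤ K := by
      refine IsCyclic.subgroup_le_of_card_dvd ?_
      have hKc := K.index_mul_card
      rw [hK, hS] at hKc
      rw [Nat.eq_of_mul_eq_mul_left hp.pos hKc,
        Subgroup.card_map_of_injective (f := e.toMonoidHom) e.injective]
      have h1 := Subgroup.map_mono (f := (sylowIn p (⊤ : Subgroup G)).subtype) hI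
      rw [Subgroup.subgroupOf_map_subtype] at h1
      have h2 := Subgroup.card_dvd_of_le (h1.trans inf_le_left)
      rwa [Subgroup.card_map_of_injective (Subgroup.subtype_injective _),
        Subgroup.card_map_of_injective (Subgroup.subtype_injective _)] at h2
    rw [BurnsideRing.mark_pullback, map_sub, map_natCast, BurnsideRing.mark_coset, if_pos hIK, hK,
      sub_self]
    exact dvd_zero _
  have hxe : BurnsideRing.pullback e.symm.toMonoidHom x =
      BurnsideRing.of (FinGSet.coset K) - (p : BurnsideRing _) := by
    refine BurnsideRing.eq_of_mark_eq fun I => ?_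
    rw [BurnsideRing.mark_pullback, BurnsideRing.mark_pullback, Subgroup.map_map]
    congr 1
    have h : e.toMonoidHom.comp e.symm.toMonoidHom = MonoidHom.id _ := by
      ext y
      exact congrArg _ (e.apply_symm_apply y)
    rw [h, Subgroup.map_id]
  rw [← hxe]
  exact hx

end TambaraIdeal

theorem theorem4p9 {G : Type u} [Group G] [Finite G] [IsCyclic G] (C : Subgroup G)
    (q : ℕ) (hq : q.Prime ∨ q = 0)
    (P : TambaraIdeal G) (hP : P.IsPrime) (hPq : P.IsOver q) :
    ((∀ p : ℕ, p.Prime → p ∣ Nat.card G → sylowIn p C ≠ sylowIn p (⊤ : Subgroup G) →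
        -- `H` is the subgroup of order `p |Syl_p(C)|` and `[H/K]` is the class `t_p` in `A(H)`
        ∀ H : Subgroup G, Nat.card H = p * Nat.card (sylowIn p C) →
          ∀ K : Subgroup H, K.index = p →
            BurnsideRing.of (FinGSet.coset K) - (p : BurnsideRing H) ∈ P.level H) →
      ∀ H : Subgroup G, burnsidePrime C q H ≤ P.level H) ∧
    ((∀ p : ℕ, p.Prime → p ∣ Nat.card G →
        P.restrict (sylowIn p (⊤ : Subgroup G)) =
          burnsidePrime ((sylowIn p C).subgroupOf (sylowIn p (⊤ : Subgroup G))) q) →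
      ∀ H : Subgroup G, burnsidePrime C q H ≤ P.level H) := by

  have part1 : (∀ p : ℕ, p.Prime → p ∣ Nat.card G → sylowIn p C ≠ sylowIn p (⊤ : Subgroup G) →
      ∀ H : Subgroup G, Nat.card H = p * Nat.card (sylowIn p C) →
        ∀ K : Subgroup H, K.index = p →
          BurnsideRing.of (FinGSet.coset K) - (p : BurnsideRing H) ∈ P.level H) →
      ∀ H : Subgroup G, burnsidePrime C q H ≤ P.level H := by
    intro h
    refine TambaraIdeal.burnsidePrime_le_of_coset_sub_mem hq hP hPq fun p hp S hS => ?_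
    have := Fact.mk hp
    have hSG : p ^ ((Nat.card C).factorization p + 1) ∣ Nat.card G :=
      hS ▸ Subgroup.card_subgroup_dvd_card S
    -- A subgroup `S` of this order already forces `p` to divide `|G|` and the `p`-part of `C` to be
    -- smaller than that of `G`, so the restrictions on `p` in the statement cost nothing.
    refine h p hp ((dvd_pow_self p (Nat.succ_ne_zero _)).trans hSG) (fun heq => ?_) S
      (by rw [hS, card_sylowIn, pow_succ'])
    have hcard := congrArg (fun L : Subgroup G => Nat.card L) heq
    simp only [card_sylowIn, Subgroup.card_top] at hcard
    have := (hp.pow_dvd_iff_le_factorization Nat.card_pos.ne').1 hSG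
    have := Nat.pow_right_injective hp.two_le hcard
    omega
  exact ⟨part1, fun h => part1 fun p hp hpG _ S hS K hK =>
    TambaraIdeal.coset_sub_mem_of_restrict_eq hp (h p hp hpG) S hS K hK⟩
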